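/- **Conventions.** Let $\mathbb{C}_+=\{s:\operatorname{Re}s>0\}$ and $\mathbb{R}_+=[0,\infty)$. The Laplace transform of $g$ is $\mathcal L(g)(s)=\int_0^\infty e^{-st}g(t)\,dt$. $H^p(\mathbb{C}_+)$ is the space of analytic functions $F$ on $\mathbb{C}_+$ for which $\left(\frac1{2\pi}\int_{-\infty}^{\infty}|F(x+iy)|^p\,dy\right)^{1/p}$ is bounded uniformly in $x>0$. For $G$ analytic on $\mathbb{C}_+$, $\mathcal L^{-1}(G)$ denotes the element $g$ of $L^{p'}(\mathbb{R}_+)$ with $\mathcal L(g)=G$ on $\mathbb{C}_+$. Quotients by $f$ are quotients of analytic functions, with removable singularities removed. Given $r_0$, a *solution* of $f(\partial_t)\phi=J$ with generalized initial condition $r_0$ is a $\phi\in L^{p'}(\mathbb{R}_+)$ such that $f\,\mathcal L(\phi)-r_0\in H^p(\mathbb{C}_+)$ and $\mathcal L^{-1}(f\,\mathcal L(\phi)-r_0)=J$. **Theorem.** Let $1<p\le 2$, $1/p+1/p'=1$, $N\ge 0$, let $r_1,\dots,r_N$ be positive integers, and set $K=\sum_{i=1}^N r_i$. Let $f\not\equiv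 0$ be analytic in a region $D\supseteq\mathbb{C}_+$. Let $J\in L^{p'}(\mathbb{R}_+)$ satisfy $\mathcal L(J)\in H^p(\mathbb{C}_+)$ and $\mathcal L(J)/f\in H^p(\mathbb{C}_+)$. Assume that for some integer $M\ge K$ and some $\sigma>0$ the functions $y\mapsto y^n\,\mathcal L(J)(\sigma+iy)/f(\sigma+iy)$, $n=0,\dots,M$, belong to $L^1(\mathbb{R})$. Let $\Delta(\omega_1,\dots,\omega_N)$ be the determinant of the $K\times K$ matrix with entry $\binom{n}{j}\omega_i^{\,n-j}$ in row $n\in\{0,\dots,K-1\}$ and column $(i,j)$, $1\le i\le N$, $0\le j<r_i$ (the entry being $0$ for $n<j$). Then $\Delta$ is not the zero polynomial. Moreover, for all points $\omega_1,\dots,\omega_N$ with $\operatorname{Re}\omega_i<0$ and $\Delta(\omega_1,\dots,\omega_N)\ne0$ there are affine hyperplanes $H_1,\dots,H_N\subset\mathbb{C}^K$ such that the following holds. For every $(\phi_0,\dots,\phi_{K-1})\in\mathbb{C}^K$ there is exactly one function $r_0$, analytic on $D\setminus\{\omega_1,\dots,\omega_N\}$, satisfying * $(\alpha)$ $r_0/f\in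 H^p(\mathbb{C}_+)$, and $r_0/f$ continues meromorphically to $\mathbb{C}$ with no poles except possibly at the $\omega_i$, the order at $\omega_i$ being at most $r_i$; * $(\beta)$ $(\mathcal L(J)+r_0)/f\in H^p(\mathbb{C}_+)$; * $(\gamma)$ there are $q\ge1$ and a constant $C$ with $|(r_0/f)(s)|\le C/|s|^q$ for all sufficiently large $|s|$, where $r_0/f$ denotes the continuation; * $(\delta)$ $f(\partial_t)\phi=J$ with generalized initial condition $r_0$ has a solution $\phi$ which is of class $C^K$ on $[0,\infty)$ and satisfies $\phi^{(n)}(0)=\phi_n$ for $n=0,\dots,K-1$. The solution in $(\delta)$ is unique as an element of $L^{p'}(\mathbb{R}_+)$ and is given by $\phi=\mathcal L^{-1}\big((\mathcal L(J)+r_0)/f\big)$. Finally, for each $i$, the pole of $r_0/f$ at $\omega_i$ has order exactly $r_i$ if and only if $(\phi_0,\dots,\phi_{K-1})\notin H_i$. -/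

import Mathlib

open MeasureTheory Set Filter
open scoped ENNReal

/-- The open right half-plane `{s : Re s > 0}`. -/
def rightHalfPlane : Set ℂ := {s : ℂ | 0 < s.re}

/-- Lebesgue measure on the half-line `t ≥ 0` (the end point is a null set). -/
noncomputable def halfLine : Measure ℝ := (volume : Measure ℝ).restrict (Ioi 0)

/-- Membership in `L^q(ℝ₊)`. -/
def MemLpHalfLine (q : ℝ) (g : ℝ → ℂ) : Prop := MemLp g (ENNReal.ofReal q) halfLine

/-- The Laplace transform `s ↦ ∫₀^∞ e^{-st} g(t) dt`. -/
noncomputable def laplace (g : ℝ → ℂ) (s : ℂ) : ℂ :=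
  ∫ t, Complex.exp (-s * (t : ℂ)) * g t ∂halfLine

/-- The mean `((1/2π) ∫ |F(x+iy)|^q dy)^{1/q}` on the vertical line `Re s = x`, valued in
`[0,∞]`. -/
noncomputable def hardyMean (q : ℝ) (F : ℂ → ℂ) (x : ℝ) : ℝ≥0∞ :=
  (ENNReal.ofReal (1 / (2 * Real.pi)) *
    ∫⁻ y : ℝ, ‖F ((x : ℂ) + (y : ℂ) * Complex.I)‖ₑ ^ q) ^ (1 / q)

/-- Membership in the Hardy space `H^q` of the right half-plane: `F` is analytic there and its
means on vertical lines are uniformly bounded. -/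
def MemHardy (q : ℝ) (F : ℂ → ℂ) : Prop :=
  AnalyticOnNhd ℂ F rightHalfPlane ∧
    ∃ C : ℝ≥0∞, C ≠ ∞ ∧ ∀ x : ℝ, 0 < x → hardyMean q F x ≤ C

/-- `G` is the quotient `F / f` on the right half-plane and it belongs to `H^q`. The quotient is
understood as a quotient of analytic functions (`f` is not identically zero in the applications),
so that singularities at zeros of `f` which are removable are removed. -/
def IsHardyQuotient (q : ℝ) (F f G : ℂ → ℂ) : Prop :=
  MemHardy q G ∧ ∀ s ∈ rightHalfPlane, f s * G s = F s

/-- The quotient `F / f` belongs to `H^q`. -/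
def QuotientMemHardy (q : ℝ) (F f : ℂ → ℂ) : Prop := ∃ G : ℂ → ℂ, IsHardyQuotient q F f G

/-- `g` is the inverse Laplace transform of `G` in `L^q(ℝ₊)`: it is the element of `L^q(ℝ₊)` whose
Laplace transform is `G` on the right half-plane. -/
def IsInverseLaplace (q : ℝ) (G : ℂ → ℂ) (g : ℝ → ℂ) : Prop :=
  MemLpHalfLine q g ∧ ∀ s ∈ rightHalfPlane, laplace g s = G s

/-- `φ` solves `f(∂_t) φ = J` with generalized initial condition `r`: `φ ∈ L^{p'}(ℝ₊)`, the function
`f · 𝓛(φ) - r` is in `H^p`, and its inverse Laplace transform is `J`. -/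
def IsNonlocalSolution (p p' : ℝ) (f r : ℂ → ℂ) (J φ : ℝ → ℂ) : Prop :=
  MemLpHalfLine p' φ ∧
    MemHardy p (fun s => f s * laplace φ s - r s) ∧
    IsInverseLaplace p' (fun s => f s * laplace φ s - r s) J

/-- `R` is analytic in the plane except for poles at the points `ω i`, the pole at `ω i` being of
order at most `r i`. -/
def HasPolesAtMost {N : ℕ} (ω : Fin N → ℂ) (r : Fin N → ℕ) (R : ℂ → ℂ) : Prop :=
  AnalyticOnNhd ℂ R (range ω)ᶜ ∧
    ∀ i, MeromorphicAt R (ω i) ∧ ((-(r i : ℤ) : ℤ) : WithTop ℤ) ≤ meromorphicOrderAt R (ω i)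

/-- `R` has a pole of order exactly `m` at `w`. -/
def HasPoleOfOrder (R : ℂ → ℂ) (w : ℂ) (m : ℕ) : Prop :=
  MeromorphicAt R w ∧ meromorphicOrderAt R w = ((-(m : ℤ) : ℤ) : WithTop ℤ)

/-- The three requirements on `r₀`, where `R` is the quotient `r₀ / f` continued meromorphically to
the plane: `R` has no poles but the `ω i`, of orders at most `r i`, and is in `H^p`; the function
`(𝓛(J) + r₀) / f` is in `H^p`; and `|R(s)| ≤ C / |s|^q` for some `q ≥ 1` and all large `|s|`. -/
structure IsAdmissible {N : ℕ} (p : ℝ) (D : Set ℂ) (f : ℂ → ℂ) (J : ℝ → ℂ)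
    (ω : Fin N → ℂ) (r : Fin N → ℕ) (r₀ R : ℂ → ℂ) : Prop where
  analytic : AnalyticOnNhd ℂ r₀ (D \ range ω)
  quotient : ∀ s ∈ D \ range ω, f s * R s = r₀ s
  poles : HasPolesAtMost ω r R
  memHardy : MemHardy p R
  memHardy_add : QuotientMemHardy p (fun s => laplace J s + r₀ s) f
  decay : ∃ q : ℝ, 1 ≤ q ∧ ∃ C S : ℝ, 0 < S ∧ ∀ s : ℂ, S ≤ ‖s‖ → ‖R s‖ ≤ C / ‖s‖ ^ q

/-- `φ` is of class `C^K` on `[0,∞)` and `φ^{(n)}(0) = d n` for `n < K` (one-sided derivatives). -/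
def HasInitialData {K : ℕ} (d : Fin K → ℂ) (φ : ℝ → ℂ) : Prop :=
  ContDiffOn ℝ (K : WithTop ℕ∞) φ (Ici 0) ∧
    ∀ n : Fin K, iteratedDerivWithin n φ (Ici 0) 0 = d n

/-- The matrix of the linear system for the coefficients `a i j` (`j < r i`) in
`φ^{(n)}(0) = L n + (d/dt)^n|₀ ∑ i, (∑ j, a i j t^j / j!) e^{ω i t}`, `n < K = ∑ i, r i`: the entry
in row `n` and column `(i, j)` is `(d/dt)^n|₀ (t^j / j!) e^{ω i t} = binom(n, j) (ω i)^{n - j}`,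
which is zero for `n < j`. The points `ω i` are the indeterminates. -/
noncomputable def initialMatrix {N : ℕ} (r : Fin N → ℕ) :
    Matrix (Fin (∑ i, r i)) (Fin (∑ i, r i)) (MvPolynomial (Fin N) ℂ) :=
  Matrix.of fun n c =>
    MvPolynomial.C ((Nat.choose (n : ℕ) ((finSigmaFinEquiv.symm c).2 : ℕ) : ℕ) : ℂ) *
      MvPolynomial.X (finSigmaFinEquiv.symm c).1 ^
        ((n : ℕ) - ((finSigmaFinEquiv.symm c).2 : ℕ))

/-- The main determinant of the linear system, as a polynomial in the points `ω i`. -/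
noncomputable def initialDet {N : ℕ} (r : Fin N → ℕ) : MvPolynomial (Fin N) ℂ :=
  (initialMatrix r).det

/-! On the Laplace side the equation says that a solution has transform `G + R`, where `G = 𝓛(J)/f`
and `R = r₀/f`. Since `R` decays at infinity and has only poles of bounded order at the `ω i`,
subtracting its principal parts leaves an entire function tending to zero, so Liouville makes `R` a
partial fraction with coefficients `a i j` (`exists_eq_partialFraction`). This is the transform of
`∑ a i j (t^j / j!) e^{ω i t}`, so every candidate is `φ₀` plus such an exponential polynomial, with
`φ₀` the inverse transform of `G`. Prescribing the first `K` derivatives at `0` is a square linear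
system for the `a i j`, whose matrix is a confluent Vandermonde matrix. Where its determinant is
nonzero the data determine the coefficients, hence `R` and `r₀`. The pole at `ω i` has full order
exactly when its top coefficient is nonzero, and this coefficient is a nonconstant affine function
of the data.

The analytic work is to show that `φ₀`, defined as the Bromwich integral of `G` over `Re s = σ`,
lies in `L^{p'}` and has transform `G` (`isInverseLaplace_bromwich`). Damping `G` by `1/(1+εs)²`
makes it integrable on all vertical lines with a uniform bound. A contour shift
(`integral_vertical_eq`) then makes the Bromwich integral independent of the line and zero for `t <
0`, and Fourier inversion recovers the transform. Hausdorff-Young (`exists_eLpNorm_fourier_le`)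
bounds the `L^{p'}` norms uniformly in `ε`, and the bound survives `ε → 0`. The moment hypothesis on
the line `Re s = σ` gives `φ₀` its derivatives. -/

/-! ### Confluent Vandermonde determinant. -/

section ConfluentVandermonde

open Polynomial

/-- A polynomial whose Hasse derivatives of order `< m` vanish at `t` is divisible by
`(X - t)^m`. -/
theorem X_sub_C_pow_dvd_of_hasseDeriv {P : ℂ[X]} {t : ℂ} {m : ℕ}
    (h : ∀ j < m, (hasseDeriv j P).eval t = 0) : (X - C t) ^ m ∣ P := by
  rw [X_sub_C_pow_dvd_iff, X_pow_dvd_iff]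
  intro j hj
  have := taylor_coeff t P j
  rw [taylor_apply] at this
  rw [this, h j hj]

variable {N : ℕ} {r : Fin N → ℕ}

/-- The matrix of the linear system at given points `ω i`. -/
noncomputable def evalInitialMatrix (r : Fin N → ℕ) (ω : Fin N → ℂ) :
    Matrix (Fin (∑ i, r i)) (Fin (∑ i, r i)) ℂ :=
  (initialMatrix r).map (MvPolynomial.eval ω)

theorem evalInitialMatrix_apply (ω : Fin N → ℂ) (n c : Fin (∑ i, r i)) :
    evalInitialMatrix r ω n c = (Nat.choose (n : ℕ) ((finSigmaFinEquiv.symm c).2 : ℕ) : ℂ) *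
      ω (finSigmaFinEquiv.symm c).1 ^ ((n : ℕ) - ((finSigmaFinEquiv.symm c).2 : ℕ)) := by
  simp [evalInitialMatrix, initialMatrix]

theorem evalInitialMatrix_apply_sigma (ω : Fin N → ℂ) (n : Fin (∑ i, r i))
    (c : (i : Fin N) × Fin (r i)) :
    evalInitialMatrix r ω n (finSigmaFinEquiv c) =
      (Nat.choose (n : ℕ) (c.2 : ℕ) : ℂ) * ω c.1 ^ ((n : ℕ) - (c.2 : ℕ)) := by
  rw [evalInitialMatrix_apply, Equiv.symm_apply_apply]

theorem det_evalInitialMatrix (ω : Fin N → ℂ) :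
    (evalInitialMatrix r ω).det = MvPolynomial.eval ω (initialDet r) := by
  rw [initialDet, RingHom.map_det]
  rfl

/-- A left null vector lists the coefficients of a polynomial of degree less than `∑ r i`. Column
`(i, j)` says that its `j`-th Hasse derivative vanishes at `ω i`, so the polynomial is divisible by
`∏ (X - ω i)^{r i}`, which has too large a degree. -/
theorem det_evalInitialMatrix_ne_zero {ω : Fin N → ℂ} (hω : Function.Injective ω) :
    (evalInitialMatrix r ω).det ≠ 0 := by
  intro h0
  obtain ⟨v, hv, hM⟩ := Matrix.exists_vecMul_eq_zero_iff.2 h0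
  apply hv
  set P : ℂ[X] := ∑ n : Fin (∑ i, r i), monomial (n : ℕ) (v n) with hP
  have hcoeff : ∀ n : Fin (∑ i, r i), P.coeff n = v n := by
    intro n
    simp [hP, coeff_monomial, Fin.val_inj]
  have hdvd : ∀ i, (X - C (ω i)) ^ r i ∣ P := by
    intro i
    apply X_sub_C_pow_dvd_of_hasseDeriv
    intro j hj
    have := congrFun hM (finSigmaFinEquiv ⟨i, ⟨j, hj⟩⟩)
    simp only [Matrix.vecMul, dotProduct, evalInitialMatrix_apply_sigma,
      Pi.zero_apply] at this
    rw [hP, map_sum, eval_finsetSum, ← this]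
    refine Finset.sum_congr rfl fun n _ => ?_
    rw [hasseDeriv_monomial, eval_monomial]
    ring
  have hprod : (∏ i, (X - C (ω i)) ^ r i) ∣ P := by
    refine Finset.prod_dvd_of_coprime (fun i _ j _ hij => ?_) fun i _ => hdvd i
    exact (pairwise_coprime_X_sub_C hω hij).pow
  have hP0 : P = 0 := by
    refine eq_zero_of_dvd_of_degree_lt hprod ?_
    have hdeg : (∏ i, (X - C (ω i)) ^ r i).degree = ((∑ i, r i : ℕ) : WithBot ℕ) := by
      simp [degree_prod]
    rw [hdeg, degree_lt_iff_coeff_zero]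
    intro m hm
    rw [hP, finsetSum_coeff]
    refine Finset.sum_eq_zero fun n _ => ?_
    rw [coeff_monomial, if_neg]
    have := n.2
    omega
  funext n
  rw [← hcoeff n, hP0, coeff_zero, Pi.zero_apply]

theorem initialDet_ne_zero (r : Fin N → ℕ) : initialDet r ≠ 0 := by
  intro h
  have h1 := det_evalInitialMatrix_ne_zero (r := r) (ω := fun i : Fin N => ((i : ℕ) : ℂ))
    (fun i j hij => Fin.ext (Nat.cast_injective hij))
  rw [det_evalInitialMatrix, h, map_zero] at h1
  exact h1 rfl

/-- Two coinciding points would produce equal columns `(i, 0)` and `(k, 0)`. -/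
theorem injective_of_eval_initialDet_ne_zero (hr : ∀ i, 0 < r i) {ω : Fin N → ℂ}
    (h : MvPolynomial.eval ω (initialDet r) ≠ 0) : Function.Injective ω := by
  intro i k hik
  by_contra hne
  apply h
  rw [← det_evalInitialMatrix]
  refine Matrix.det_zero_of_column_eq (i := finSigmaFinEquiv ⟨i, ⟨0, hr i⟩⟩)
    (j := finSigmaFinEquiv ⟨k, ⟨0, hr k⟩⟩) ?_ ?_
  · intro he
    exact hne (congrArg Sigma.fst (finSigmaFinEquiv.injective he))
  · intro n
    simp [evalInitialMatrix_apply_sigma, hik]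

end ConfluentVandermonde

/-! ### Exponential monomials: derivatives at zero and Laplace transforms. -/

section ExpMonomial

open Topology

/-- The function `t ↦ (t^j / j!) e^{ω t}`. -/
noncomputable def expMonomial (ω : ℂ) (j : ℕ) (t : ℝ) : ℂ :=
  (t : ℂ) ^ j / (j.factorial : ℂ) * Complex.exp (ω * t)

theorem contDiff_expMonomial (ω : ℂ) (j : ℕ) {n : WithTop ℕ∞} :
    ContDiff ℝ n (expMonomial ω j) := by
  unfold expMonomial
  have h : ContDiff ℝ n (fun t : ℝ => (t : ℂ)) := Complex.ofRealCLM.contDiff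
  exact ((h.pow j).div_const _).mul (contDiff_const.mul h).cexp

theorem hasDerivAt_expMonomial_zero (ω : ℂ) (t : ℝ) :
    HasDerivAt (expMonomial ω 0) (ω * expMonomial ω 0 t) t := by
  have h : HasDerivAt (fun t : ℝ => ω * (t : ℂ)) ω t := by
    simpa using (Complex.ofRealCLM.hasDerivAt (x := t)).const_mul ω
  convert! h.cexp using 1
  · funext t
    simp [expMonomial]
  · simp [expMonomial, mul_comm]

theorem hasDerivAt_expMonomial_succ (ω : ℂ) (j : ℕ) (t : ℝ) :
    HasDerivAt (expMonomial ω (j + 1)) (ω * expMonomial ω (j + 1) t + expMonomial ω j t) t := by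
  have h1 : HasDerivAt (fun t : ℝ => (t : ℂ)) 1 t := by
    simpa using (hasDerivAt_id t).ofReal_comp
  have h : HasDerivAt (fun t : ℝ => ω * (t : ℂ)) ω t := by
    simpa using h1.const_mul ω
  have h2 := ((h1.fun_pow (j + 1)).div_const ((j + 1).factorial : ℂ)).mul h.cexp
  convert! h2 using 1
  have hj : (j.factorial : ℂ) ≠ 0 := by exact_mod_cast j.factorial_ne_zero
  have hj' : ((j : ℂ) + 1) ≠ 0 := by exact_mod_cast j.succ_ne_zero
  simp only [expMonomial, Nat.factorial_succ, Nat.add_sub_cancel]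
  push_cast
  field_simp
  ring

theorem iteratedDeriv_expMonomial_zero (ω : ℂ) (n j : ℕ) :
    iteratedDeriv n (expMonomial ω j) 0 = (n.choose j : ℂ) * ω ^ (n - j) := by
  induction n generalizing j with
  | zero =>
    cases j with
    | zero => simp [expMonomial]
    | succ j => simp [expMonomial]
  | succ n ih =>
    rw [iteratedDeriv_succ']
    cases j with
    | zero =>
      have : deriv (expMonomial ω 0) = fun t => ω * expMonomial ω 0 t :=
        funext fun t => (hasDerivAt_expMonomial_zero ω t).deriv
      rw [this, iteratedDeriv_const_mul_field, ih]
      simp [pow_succ, mul_comm]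
    | succ j =>
      have : deriv (expMonomial ω (j + 1)) =
          (fun t => ω * expMonomial ω (j + 1) t) + expMonomial ω j :=
        funext fun t => (hasDerivAt_expMonomial_succ ω j t).deriv
      rw [this, iteratedDeriv_add (contDiff_const.mul (contDiff_expMonomial ω _)).contDiffAt
        (contDiff_expMonomial ω _).contDiffAt, iteratedDeriv_const_mul_field, ih, ih,
        Nat.choose_succ_succ, Nat.add_sub_add_right]
      push_cast
      -- Pascal's rule closes the induction when the truncated subtraction `n - (j + 1)` is genuine;
      -- otherwise `n.choose (j + 1) = 0` removes that term.
      rcases Nat.lt_or_ge j n with hlt | hge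
      · have : n - j = (n - (j + 1)) + 1 := by omega
        rw [this, pow_succ]
        ring
      · rw [Nat.choose_eq_zero_of_lt (show n < j + 1 by omega)]
        simp

theorem norm_expMonomial (ω : ℂ) (j : ℕ) {t : ℝ} (ht : 0 ≤ t) :
    ‖expMonomial ω j t‖ = t ^ j / j.factorial * Real.exp (ω.re * t) := by
  simp [expMonomial, Complex.norm_exp, abs_of_nonneg ht]

theorem memLpHalfLine_expMonomial {ω : ℂ} (hω : ω.re < 0) (j : ℕ) {q : ℝ} (hq : 0 < q) :
    MemLpHalfLine q (expMonomial ω j) := by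
  have hm : AEStronglyMeasurable (expMonomial ω j) halfLine :=
    (contDiff_expMonomial ω j (n := 0)).continuous.aestronglyMeasurable
  have hq0 : ENNReal.ofReal q ≠ 0 := by simpa using hq
  refine (integrable_norm_rpow_iff hm hq0 ENNReal.ofReal_ne_top).1 ?_
  rw [ENNReal.toReal_ofReal hq.le]
  have h1 := integrableOn_rpow_mul_exp_neg_mul_rpow (p := 1) (s := j * q) (b := q * -ω.re)
    (lt_of_lt_of_le (by norm_num) (mul_nonneg (Nat.cast_nonneg j) hq.le)) one_pos
    (mul_pos hq (neg_pos.2 hω))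
  have h2 : IntegrableOn (fun t : ℝ => ((j.factorial : ℝ) ^ q)⁻¹ *
      (t ^ (j * q) * Real.exp (-(q * -ω.re) * t ^ (1 : ℝ)))) (Ioi 0) := h1.const_mul _
  refine h2.congr_fun (fun t ht => ?_) measurableSet_Ioi
  have ht' : (0 : ℝ) < t := ht
  simp only
  rw [norm_expMonomial ω j ht'.le, Real.mul_rpow (by positivity) (by positivity),
    Real.div_rpow (by positivity) (by positivity), ← Real.exp_mul, Real.rpow_one,
    Real.rpow_mul ht'.le, Real.rpow_natCast]
  have : -(q * -ω.re) * t = ω.re * t * q := by ring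
  rw [this]
  field_simp

theorem integrable_expMonomial {ω : ℂ} (hω : ω.re < 0) (j : ℕ) :
    Integrable (expMonomial ω j) halfLine := by
  have := memLpHalfLine_expMonomial hω j one_pos
  rwa [MemLpHalfLine, ENNReal.ofReal_one, memLp_one_iff_integrable] at this

theorem tendsto_expMonomial_atTop {ω : ℂ} (hω : ω.re < 0) (j : ℕ) :
    Tendsto (expMonomial ω j) atTop (𝓝 0) := by
  rw [tendsto_zero_iff_norm_tendsto_zero]
  have h := (tendsto_rpow_mul_exp_neg_mul_atTop_nhds_zero j (-ω.re) (neg_pos.2 hω)).const_mul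
    ((j.factorial : ℝ)⁻¹)
  rw [mul_zero] at h
  refine h.congr' ?_
  filter_upwards [eventually_ge_atTop 0] with t ht
  rw [norm_expMonomial ω j ht, Real.rpow_natCast, neg_neg]
  field_simp

theorem integral_expMonomial {ω : ℂ} (hω : ω.re < 0) (j : ℕ) :
    ∫ t, expMonomial ω j t ∂halfLine = ((-ω) ^ (j + 1))⁻¹ := by
  have hω0 : ω ≠ 0 := by
    rintro rfl
    simp at hω
  induction j with
  | zero =>
    have h := integral_Ioi_of_hasDerivAt_of_tendsto' (a := 0)
      (fun t _ => hasDerivAt_expMonomial_zero ω t)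
      ((integrable_expMonomial hω 0).const_mul ω) (tendsto_expMonomial_atTop hω 0)
    rw [integral_const_mul] at h
    have h0 : expMonomial ω 0 0 = 1 := by simp [expMonomial]
    rw [h0] at h
    rw [halfLine, zero_add, pow_one]
    field_simp
    linear_combination h
  | succ j ih =>
    have h := integral_Ioi_of_hasDerivAt_of_tendsto' (a := 0)
      (fun t _ => hasDerivAt_expMonomial_succ ω j t)
      (((integrable_expMonomial hω (j + 1)).const_mul ω).add (integrable_expMonomial hω j))
      (tendsto_expMonomial_atTop hω (j + 1))
    have h' := integral_add ((integrable_expMonomial hω (j + 1)).const_mul ω)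
      (integrable_expMonomial hω j)
    rw [ih, integral_const_mul] at h'
    have h0 : expMonomial ω (j + 1) 0 = 0 := by simp [expMonomial]
    rw [h0, sub_zero] at h
    rw [← halfLine, h'] at h
    have h3 : ∫ t, expMonomial ω (j + 1) t ∂halfLine = ((-ω) ^ (j + 1))⁻¹ * (-ω)⁻¹ := by
      rw [eq_comm, ← div_eq_mul_inv, div_eq_iff (neg_ne_zero.2 hω0)]
      linear_combination h
    rw [h3, ← mul_inv, ← pow_succ]

theorem laplace_expMonomial {ω : ℂ} (j : ℕ) {s : ℂ} (h : ω.re < s.re) :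
    laplace (expMonomial ω j) s = ((s - ω) ^ (j + 1))⁻¹ := by
  have h1 := integral_expMonomial (ω := ω - s) (by simpa using h) j
  rw [neg_sub] at h1
  rw [← h1, laplace]
  congr 1
  funext t
  rw [expMonomial, expMonomial, mul_left_comm, ← Complex.exp_add]
  ring_nf

end ExpMonomial

/-! ### Principal parts, Liouville's theorem and pole orders. -/

section PartialFractions

open Topology

/-- Laurent expansion at a pole of order at most `m`. -/
theorem exists_principalPart {w : ℂ} (m : ℕ) {R : ℂ → ℂ} (hR : MeromorphicAt R w)
    (ho : ((-(m : ℤ) : ℤ) : WithTop ℤ) ≤ meromorphicOrderAt R w) :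
    ∃ (a : Fin m → ℂ) (h : ℂ → ℂ), AnalyticAt ℂ h w ∧
      ∀ᶠ s in 𝓝[≠] w, R s = ∑ j, a j * ((s - w) ^ ((j : ℕ) + 1))⁻¹ + h s := by
  induction m generalizing R with
  | zero =>
    refine ⟨Fin.elim0, toMeromorphicNFAt R w, ?_, ?_⟩
    · exact hR.meromorphicOrderAt_nonneg_iff_analyticAt_toMeromorphicNFAt.1 (by simpa using ho)
    · filter_upwards [hR.eq_nhdsNE_toMeromorphicNFAt] with s hs
      simpa using hs
  | succ m ih =>
    have hid : MeromorphicAt (fun s : ℂ => s - w) w := by fun_prop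
    have hm : MeromorphicAt (fun s => (s - w) * R s) w := hid.mul hR
    have hid1 : meromorphicOrderAt (fun s : ℂ => s - w) w = 1 :=
      meromorphicOrderAt_id_sub_const
    have ho' : ((-(m : ℤ) : ℤ) : WithTop ℤ) ≤
        meromorphicOrderAt (fun s => (s - w) * R s) w := by
      rw [fun_meromorphicOrderAt_mul hid hR, hid1]
      refine le_trans ?_ (add_le_add_right ho 1)
      rw [← WithTop.coe_one, ← WithTop.coe_add, WithTop.coe_le_coe]
      push_cast
      omega
    obtain ⟨a, h, hh, he⟩ := ih hm ho'
    -- Dividing the expansion of `(s - w) R` by `s - w` shifts its coefficients up by one; the value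
    -- `h w` of the regular part becomes the residue.
    refine ⟨Fin.cons (h w) a, dslope h w, ?_, ?_⟩
    · exact hh.choose_spec.has_fpower_series_dslope_fslope.analyticAt
    · filter_upwards [he, self_mem_nhdsWithin] with s hs hsw
      have hsw' : s - w ≠ 0 := sub_ne_zero.2 hsw
      have hd : h s = h w + (s - w) * dslope h w s := by
        rw [← smul_eq_mul, sub_smul_dslope]
        ring
      rw [hd] at hs
      apply mul_left_cancel₀ hsw'
      rw [hs, Fin.sum_univ_succ]
      simp only [Fin.cons_zero, Fin.cons_succ, Fin.val_zero, Fin.val_succ, mul_add,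
        Finset.mul_sum]
      have : ∀ j : Fin m, (s - w) * (a j * ((s - w) ^ ((j : ℕ) + 1 + 1))⁻¹) =
          a j * ((s - w) ^ ((j : ℕ) + 1))⁻¹ := by
        intro j
        rw [mul_left_comm, pow_succ' _ ((j : ℕ) + 1), mul_inv, mul_inv_cancel_left₀ hsw']
      simp only [this]
      field_simp
      ring

/-- A function with removable singularities only agrees with an entire function. -/
theorem exists_entire_of_removable {E : ℂ → ℂ}
    (hE : ∀ s, ∃ g : ℂ → ℂ, AnalyticAt ℂ g s ∧ E =ᶠ[𝓝[≠] s] g) :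
    ∃ F : ℂ → ℂ, Differentiable ℂ F ∧ ∀ s, AnalyticAt ℂ E s → E s = F s := by
  have hm : MeromorphicOn E univ := by
    intro s _
    obtain ⟨g, hg, he⟩ := hE s
    exact hg.meromorphicAt.congr he.symm
  refine ⟨toMeromorphicNFOn E univ, fun s => ?_, fun s hs => ?_⟩
  · obtain ⟨g, hg, he⟩ := hE s
    refine AnalyticAt.differentiableAt ?_
    have h1 := meromorphicNFOn_toMeromorphicNFOn E univ (mem_univ s)
    rw [← h1.meromorphicOrderAt_nonneg_iff_analyticAt,
      meromorphicOrderAt_toMeromorphicNFOn hm (mem_univ s), meromorphicOrderAt_congr he]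
    exact hg.meromorphicOrderAt_nonneg
  · rw [toMeromorphicNFOn_eq_toMeromorphicNFAt hm (mem_univ s),
      toMeromorphicNFAt_eq_self.2 hs.meromorphicNFAt]

variable {N : ℕ} {r : Fin N → ℕ}

/-- The partial fraction `∑ a_{ij} / (s - ω_i)^{j+1}`. -/
noncomputable def partialFraction (ω : Fin N → ℂ) (a : (i : Fin N) × Fin (r i) → ℂ) (s : ℂ) : ℂ :=
  ∑ c, a c * ((s - ω c.1) ^ ((c.2 : ℕ) + 1))⁻¹

theorem partialFraction_eq_sum (ω : Fin N → ℂ) (a : (i : Fin N) × Fin (r i) → ℂ) (s : ℂ) :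
    partialFraction ω a s = ∑ i, ∑ j, a ⟨i, j⟩ * ((s - ω i) ^ ((j : ℕ) + 1))⁻¹ := by
  rw [partialFraction, Fintype.sum_sigma]

theorem analyticAt_principalPart {w s : ℂ} (h : s ≠ w) {m : ℕ} (a : Fin m → ℂ) :
    AnalyticAt ℂ (fun s => ∑ j, a j * ((s - w) ^ ((j : ℕ) + 1))⁻¹) s := by
  refine Finset.analyticAt_fun_sum _ fun j _ => ?_
  refine analyticAt_const.mul (AnalyticAt.inv ?_ ?_)
  · fun_prop
  · exact pow_ne_zero _ (sub_ne_zero.2 h)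

theorem analyticOnNhd_partialFraction (ω : Fin N → ℂ) (a : (i : Fin N) × Fin (r i) → ℂ) :
    AnalyticOnNhd ℂ (partialFraction ω a) (range ω)ᶜ := by
  intro s hs
  have : partialFraction ω a =
      fun s => ∑ i, ∑ j, a ⟨i, j⟩ * ((s - ω i) ^ ((j : ℕ) + 1))⁻¹ :=
    funext (partialFraction_eq_sum ω a)
  rw [this]
  refine Finset.analyticAt_fun_sum _ fun i _ => analyticAt_principalPart ?_ _
  rintro rfl
  exact hs ⟨i, rfl⟩

/-- The sum of the principal parts at the points other than `ω i`. -/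
theorem analyticAt_sum_erase {ω : Fin N → ℂ} (hω : Function.Injective ω)
    (a : (i : Fin N) × Fin (r i) → ℂ) (i : Fin N) :
    AnalyticAt ℂ (fun s => ∑ k ∈ Finset.univ.erase i,
      ∑ j, a ⟨k, j⟩ * ((s - ω k) ^ ((j : ℕ) + 1))⁻¹) (ω i) := by
  refine Finset.analyticAt_fun_sum _ fun k hk => analyticAt_principalPart ?_ _
  exact fun h => (Finset.mem_erase.1 hk).1 (hω h).symm

theorem partialFraction_eq_add {ω : Fin N → ℂ} (a : (i : Fin N) × Fin (r i) → ℂ) (i : Fin N)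
    (s : ℂ) : partialFraction ω a s = ∑ j, a ⟨i, j⟩ * ((s - ω i) ^ ((j : ℕ) + 1))⁻¹ +
      ∑ k ∈ Finset.univ.erase i, ∑ j, a ⟨k, j⟩ * ((s - ω k) ^ ((j : ℕ) + 1))⁻¹ := by
  rw [partialFraction_eq_sum]
  exact (Finset.add_sum_erase Finset.univ
    (fun i => ∑ j, a ⟨i, j⟩ * ((s - ω i) ^ ((j : ℕ) + 1))⁻¹) (Finset.mem_univ i)).symm

theorem norm_partialFraction_le (ω : Fin N → ℂ) (a : (i : Fin N) × Fin (r i) → ℂ) :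
    ∃ C S : ℝ, 0 < S ∧ ∀ s : ℂ, S ≤ ‖s‖ → ‖partialFraction ω a s‖ ≤ C / ‖s‖ := by
  -- Beyond this radius `‖s - ω i‖` is at least `‖s‖ / 2` and at least `1`, so the higher powers are
  -- dominated by the first.
  refine ⟨∑ c, ‖a c‖ * 2, 2 + 2 * ∑ i, ‖ω i‖, ?_, fun s hs => ?_⟩
  · have : 0 ≤ ∑ i, ‖ω i‖ := Finset.sum_nonneg fun i _ => norm_nonneg _
    linarith
  · rw [Finset.sum_div]
    refine (norm_sum_le _ _).trans (Finset.sum_le_sum fun c _ => ?_)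
    have h1 : ‖ω c.1‖ ≤ ∑ i, ‖ω i‖ :=
      Finset.single_le_sum (f := fun i => ‖ω i‖) (fun i _ => norm_nonneg _) (Finset.mem_univ _)
    have h2 : ‖s‖ / 2 ≤ ‖s - ω c.1‖ := by
      have := norm_sub_norm_le s (ω c.1)
      linarith
    have h0 : 0 < ‖s‖ / 2 := by
      have := norm_nonneg (ω c.1)
      linarith
    have h3 : 1 ≤ ‖s - ω c.1‖ := by
      have := norm_nonneg (ω c.1)
      linarith
    rw [norm_mul, norm_inv, norm_pow, mul_div_assoc]
    refine mul_le_mul_of_nonneg_left ?_ (norm_nonneg _)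
    rw [← inv_div]
    refine inv_anti₀ h0 (h2.trans ?_)
    exact le_self_pow₀ h3 (Nat.succ_ne_zero _)

theorem tendsto_cocompact_of_decay {R : ℂ → ℂ} {q C S : ℝ} (hq : 0 < q)
    (h : ∀ s : ℂ, S ≤ ‖s‖ → ‖R s‖ ≤ C / ‖s‖ ^ q) : Tendsto R (cocompact ℂ) (𝓝 0) := by
  rw [tendsto_zero_iff_norm_tendsto_zero]
  have h1 : Tendsto (fun s : ℂ => C / ‖s‖ ^ q) (cocompact ℂ) (𝓝 0) :=
    ((tendsto_rpow_atTop hq).comp (tendsto_norm_cocompact_atTop (E := ℂ))).const_div_atTop C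
  refine squeeze_zero' (Eventually.of_forall fun s => norm_nonneg _) ?_ h1
  filter_upwards [(tendsto_norm_cocompact_atTop (E := ℂ)).eventually (eventually_ge_atTop S)]
    with s hs using h s hs

/-- A function which decays at infinity and has no singularities except for poles at the `ω i`, of
orders at most `r i`, is a partial fraction. -/
theorem exists_eq_partialFraction {ω : Fin N → ℂ} (hω : Function.Injective ω) {R : ℂ → ℂ}
    (hR : HasPolesAtMost ω r R) (h0 : Tendsto R (cocompact ℂ) (𝓝 0)) :
    ∃ a : (i : Fin N) × Fin (r i) → ℂ, ∀ s ∉ range ω, R s = partialFraction ω a s := by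
  choose a h hh he using fun i => exists_principalPart (r i) (hR.2 i).1 (hR.2 i).2
  set A : (i : Fin N) × Fin (r i) → ℂ := fun c => a c.1 c.2 with hA
  have han : ∀ s ∉ range ω, AnalyticAt ℂ (fun s => R s - partialFraction ω A s) s :=
    fun s hs => (hR.1 s hs).sub (analyticOnNhd_partialFraction ω A s hs)
  obtain ⟨F, hF, hFE⟩ := exists_entire_of_removable
    (E := fun s => R s - partialFraction ω A s) (by
      intro s
      by_cases hs : s ∈ range ω
      · obtain ⟨i, rfl⟩ := hs
        refine ⟨_, (hh i).sub (analyticAt_sum_erase hω A i), ?_⟩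
        filter_upwards [he i] with s hs
        rw [partialFraction_eq_add A i, hs]
        simp only [hA, Pi.sub_apply]
        ring
      · exact ⟨_, han s hs, EventuallyEq.rfl⟩)
  have hfin : ∀ᶠ s in cocompact ℂ, s ∉ range ω :=
    (finite_range ω).isCompact.compl_mem_cocompact
  have hlim : Tendsto F (cocompact ℂ) (𝓝 0) := by
    obtain ⟨C, S, -, hCS⟩ := norm_partialFraction_le ω A
    have h1 : Tendsto (partialFraction ω A) (cocompact ℂ) (𝓝 0) :=
      tendsto_cocompact_of_decay (q := 1) (C := C) (S := S) one_pos (by simpa using hCS)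
    have h2 := h0.sub h1
    rw [sub_zero] at h2
    refine h2.congr' ?_
    filter_upwards [hfin] with s hs using hFE s (han s hs)
  refine ⟨A, fun s hs => ?_⟩
  have h1 := hFE s (han s hs)
  rw [hF.apply_eq_of_tendsto_cocompact s hlim] at h1
  exact sub_eq_zero.1 h1

theorem exists_partialFraction_factorization {ω : Fin N → ℂ} (hω : Function.Injective ω)
    (a : (i : Fin N) × Fin (r i) → ℂ) {i : Fin N} (hi : 0 < r i) :
    ∃ g : ℂ → ℂ, AnalyticAt ℂ g (ω i) ∧ g (ω i) = a ⟨i, ⟨r i - 1, Nat.sub_lt hi one_pos⟩⟩ ∧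
      partialFraction ω a =ᶠ[𝓝[≠] (ω i)] fun s => (s - ω i) ^ (-(r i : ℤ)) * g s := by
  refine ⟨fun s => ∑ j : Fin (r i), a ⟨i, j⟩ * (s - ω i) ^ (r i - 1 - (j : ℕ)) +
    (s - ω i) ^ r i * ∑ k ∈ Finset.univ.erase i,
      ∑ j, a ⟨k, j⟩ * ((s - ω k) ^ ((j : ℕ) + 1))⁻¹, ?_, ?_, ?_⟩
  · refine AnalyticAt.add ?_ (AnalyticAt.mul (by fun_prop) (analyticAt_sum_erase hω a i))
    exact Finset.analyticAt_fun_sum _ fun j _ => by fun_prop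
  · simp only [sub_self]
    rw [zero_pow hi.ne', zero_mul, add_zero, Finset.sum_eq_single ⟨r i - 1, Nat.sub_lt hi one_pos⟩]
    · simp
    · intro j _ hj
      have h1 : (j : ℕ) ≠ r i - 1 := fun h => hj (Fin.ext h)
      have h2 := j.2
      rw [zero_pow (by omega), mul_zero]
    · simp
  · filter_upwards [self_mem_nhdsWithin] with s hs
    have hs' : s - ω i ≠ 0 := sub_ne_zero.2 hs
    rw [partialFraction_eq_add a i, zpow_neg, zpow_natCast, mul_add, Finset.mul_sum,
      inv_mul_cancel_left₀ (pow_ne_zero _ hs')]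
    congr 1
    refine Finset.sum_congr rfl fun j _ => ?_
    have h1 : (s - ω i) ^ r i = (s - ω i) ^ (r i - 1 - (j : ℕ)) * (s - ω i) ^ ((j : ℕ) + 1) := by
      rw [← pow_add]
      congr 1
      have := j.2
      omega
    rw [h1]
    field_simp

/-- After factoring out `(s - ω i)^{-r i}`, the remaining analytic factor takes the top coefficient
as its value at `ω i`; its order there is zero exactly when that value is nonzero. -/
theorem meromorphicOrderAt_partialFraction {ω : Fin N → ℂ} (hω : Function.Injective ω)
    (a : (i : Fin N) × Fin (r i) → ℂ) {i : Fin N} (hi : 0 < r i) :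
    MeromorphicAt (partialFraction ω a) (ω i) ∧
    ((-(r i : ℤ) : ℤ) : WithTop ℤ) ≤ meromorphicOrderAt (partialFraction ω a) (ω i) ∧
    (meromorphicOrderAt (partialFraction ω a) (ω i) = ((-(r i : ℤ) : ℤ) : WithTop ℤ) ↔
      a ⟨i, ⟨r i - 1, Nat.sub_lt hi one_pos⟩⟩ ≠ 0) := by
  obtain ⟨g, hg, hgi, he⟩ := exists_partialFraction_factorization hω a hi
  have hid : MeromorphicAt (fun s : ℂ => (s - ω i) ^ (-(r i : ℤ))) (ω i) := by fun_prop
  have ho : meromorphicOrderAt (fun s : ℂ => (s - ω i) ^ (-(r i : ℤ))) (ω i) =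
      ((-(r i : ℤ) : ℤ) : WithTop ℤ) := fun_meromorphicOrderAt_zpow_id_sub_const
  have hg0 := hg.meromorphicOrderAt_nonneg
  rw [meromorphicOrderAt_congr he, fun_meromorphicOrderAt_mul hid hg.meromorphicAt, ho, ← hgi]
  refine ⟨(hid.mul hg.meromorphicAt).congr he.symm, le_add_of_nonneg_right hg0, ?_⟩
  have h1 : meromorphicOrderAt g (ω i) = 0 ↔ g (ω i) ≠ 0 := by
    rw [← hg.meromorphicNFAt.meromorphicOrderAt_eq_zero_iff]
  rw [← h1]
  cases hh : meromorphicOrderAt g (ω i) with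
  | top =>
    rw [WithTop.add_top]
    exact iff_of_false WithTop.top_ne_coe WithTop.top_ne_zero
  | coe n =>
    norm_cast
    omega

theorem hasPolesAtMost_partialFraction {ω : Fin N → ℂ} (hω : Function.Injective ω)
    (hr : ∀ i, 0 < r i) (a : (i : Fin N) × Fin (r i) → ℂ) :
    HasPolesAtMost ω r (partialFraction ω a) :=
  ⟨analyticOnNhd_partialFraction ω a, fun i =>
    ⟨(meromorphicOrderAt_partialFraction hω a (hr i)).1,
      (meromorphicOrderAt_partialFraction hω a (hr i)).2.1⟩⟩

theorem hasPoleOfOrder_partialFraction_iff {ω : Fin N → ℂ} (hω : Function.Injective ω)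
    (a : (i : Fin N) × Fin (r i) → ℂ) {i : Fin N} (hi : 0 < r i) :
    HasPoleOfOrder (partialFraction ω a) (ω i) (r i) ↔
      a ⟨i, ⟨r i - 1, Nat.sub_lt hi one_pos⟩⟩ ≠ 0 := by
  rw [HasPoleOfOrder, (meromorphicOrderAt_partialFraction hω a hi).2.2,
    and_iff_right (meromorphicOrderAt_partialFraction hω a hi).1]

end PartialFractions

/-! ### Injectivity of the Fourier transform and Plancherel. -/

section Fourier

open Topology FourierTransform SchwartzMap ContDiff

/-- The Fourier transform is self-adjoint for the bilinear pairing of integrable functions. -/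
theorem integral_fourier_mul_eq_flip {f g : ℝ → ℂ} (hf : Integrable f) (hg : Integrable g) :
    ∫ ξ, 𝓕 f ξ * g ξ = ∫ x, f x * 𝓕 g x := by
  simpa using! (VectorFourier.integral_fourierIntegral_smul_eq_flip (L := innerₗ ℝ)
      Real.continuous_fourierChar continuous_inner hf hg)

theorem norm_fourier_le_integral_norm (f : ℝ → ℂ) (ξ : ℝ) : ‖𝓕 f ξ‖ ≤ ∫ x, ‖f x‖ :=
  VectorFourier.norm_fourierIntegral_le_integral_norm _ _ (innerₗ ℝ) f ξ

theorem continuous_fourier {f : ℝ → ℂ} (hf : Integrable f) : Continuous (𝓕 f) :=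
  VectorFourier.fourierIntegral_continuous Real.continuous_fourierChar (L := innerₗ ℝ)
    continuous_inner hf

/-- A real test function, as a complex Schwartz function. -/
noncomputable def testFunction {g : ℝ → ℝ} (hg : ContDiff ℝ ∞ g) (hs : HasCompactSupport g) :
    𝓢(ℝ, ℂ) :=
  HasCompactSupport.toSchwartzMap (f := fun x => (g x : ℂ))
    (hs.comp_left (g := ((↑) : ℝ → ℂ)) Complex.ofReal_zero)
    (Complex.ofRealCLM.contDiff.comp hg)

theorem testFunction_apply {g : ℝ → ℝ} (hg : ContDiff ℝ ∞ g) (hs : HasCompactSupport g) (x : ℝ) :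
    testFunction hg hs x = (g x : ℂ) := rfl

/-- An integrable function is determined by its Fourier transform. -/
theorem ae_eq_zero_of_fourier_eq_zero {h : ℝ → ℂ} (hh : Integrable h) (h0 : ∀ ξ, 𝓕 h ξ = 0) :
    h =ᵐ[volume] 0 := by
  refine ae_eq_zero_of_integral_contDiff_smul_eq_zero hh.locallyIntegrable fun g hg hs => ?_
  -- Every test function is itself a Fourier transform, so self-adjointness moves the pairing onto
  -- `𝓕 h = 0`.
  set G : 𝓢(ℝ, ℂ) := 𝓕⁻ (testFunction hg hs) with hG
  have h1 : 𝓕 (G : ℝ → ℂ) = fun x => (g x : ℂ) := by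
    have : 𝓕 G = testFunction hg hs := by simp [hG]
    rw [← SchwartzMap.fourier_coe, this]
    rfl
  have h2 := integral_fourier_mul_eq_flip G.integrable hh
  simp only [h0, mul_zero, integral_zero, h1] at h2
  simpa using h2

/-- Plancherel's theorem on `L¹ ∩ L²`. -/
theorem eLpNorm_fourier_two {f : ℝ → ℂ} (h1 : Integrable f) (h2 : MemLp f 2) :
    eLpNorm (𝓕 f) 2 volume = eLpNorm f 2 volume := by
  set F : Lp (α := ℝ) ℂ 2 volume := h2.toLp f with hF
  -- The `L²` transform and the integral transform are identified by pairing both with test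
  -- functions.
  have hae : (𝓕 F : Lp (α := ℝ) ℂ 2 volume) =ᵐ[volume] 𝓕 f := by
    refine ae_eq_of_integral_contDiff_smul_eq
      ((Lp.memLp (𝓕 F)).locallyIntegrable (by norm_num))
      (continuous_fourier h1).locallyIntegrable fun g hg hs => ?_
    set G : 𝓢(ℝ, ℂ) := testFunction hg hs with hG
    have h3 := congrArg (fun T => T G) (Lp.fourier_toTemperedDistribution_eq F)
    simp only [TemperedDistribution.fourier_apply, Lp.toTemperedDistribution_apply] at h3
    have h4 : ∫ x, (𝓕 G) x • F x = ∫ x, 𝓕 (G : ℝ → ℂ) x * f x := by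
      refine integral_congr_ae ?_
      filter_upwards [h2.coeFn_toLp] with x hx
      rw [hF, hx, SchwartzMap.fourier_coe, smul_eq_mul]
    rw [h4, integral_fourier_mul_eq_flip G.integrable h1] at h3
    simpa [hG, testFunction_apply] using h3.symm
  rw [← eLpNorm_congr_ae hae, ← eLpNorm_congr_ae h2.coeFn_toLp, ← hF]
  have h5 := Lp.norm_fourier_eq F
  rw [Lp.norm_def, Lp.norm_def,
    ENNReal.toReal_eq_toReal_iff' (Lp.eLpNorm_ne_top _) (Lp.eLpNorm_ne_top _)] at h5
  exact h5

end Fourier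

/-! ### Hausdorff-Young by Marcinkiewicz-type interpolation. -/

section HausdorffYoung

open Topology FourierTransform

theorem fourier_add_apply {f g : ℝ → ℂ} (hf : Integrable f) (hg : Integrable g) (ξ : ℝ) :
    𝓕 (f + g) ξ = 𝓕 f ξ + 𝓕 g ξ := by
  have h := VectorFourier.fourierIntegral_add Real.continuous_fourierChar (L := innerₗ ℝ)
    continuous_inner hf hg
  exact congrFun h ξ

/-- Bound for the distribution function of the Fourier transform by truncation at height `l`. -/
theorem measure_lt_norm_fourier_le {f : ℝ → ℂ} (hm : Measurable f) (hf : Integrable f) {p b : ℝ}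
    (hp : 1 < p) (hfb : ∫⁻ x, ‖f x‖ₑ ^ p ≤ ENNReal.ofReal b) {α l : ℝ} (hα : 0 < α)
    (hl : 0 < l) (hαl : b * l ^ (1 - p) ≤ α / 2) :
    volume {ξ | α < ‖𝓕 f ξ‖} ≤ (ENNReal.ofReal (α / 2))⁻¹ ^ (2 : ℝ) *
      ∫⁻ x, {x | ‖f x‖ ≤ l}.indicator (fun x => ‖f x‖ₑ ^ (2 : ℝ)) x := by
  have hS : MeasurableSet {x | ‖f x‖ ≤ l} := measurableSet_le hm.norm measurable_const
  set u : ℝ → ℂ := {x | ‖f x‖ ≤ l}.indicator f with hu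
  set v : ℝ → ℂ := {x | ‖f x‖ ≤ l}ᶜ.indicator f with hv
  have huv : f = u + v := (indicator_self_add_compl _ f).symm
  have hui : Integrable u := hf.indicator hS
  have hvi : Integrable v := hf.indicator hS.compl
  have hul : ∀ x, ‖u x‖ ≤ l := by
    intro x
    by_cases hx : ‖f x‖ ≤ l
    · rw [hu, indicator_of_mem (by exact hx)]
      exact hx
    · rw [hu, indicator_of_notMem (by exact hx), norm_zero]
      exact hl.le
  have hu2 : MemLp u 2 := by
    rw [memLp_two_iff_integrable_sq_norm hui.1]
    refine Integrable.mono' (hui.norm.const_mul l) (hui.1.norm.pow 2) (ae_of_all _ fun x => ?_)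
    rw [Real.norm_of_nonneg (by positivity), sq]
    exact mul_le_mul_of_nonneg_right (hul x) (norm_nonneg _)
  -- Where `‖f‖ > l` one has `‖f‖ ≤ l^{1-p} ‖f‖^p`. Hence `𝓕 v` never exceeds `α / 2`, and only `𝓕
  -- u`, controlled by Plancherel, can bring `𝓕 f` above `α`.
  have hvb : ∫ x, ‖v x‖ ≤ α / 2 := by
    rw [integral_norm_eq_lintegral_enorm hvi.1]
    refine ENNReal.toReal_le_of_le_ofReal (by positivity) ?_
    calc ∫⁻ x, ‖v x‖ₑ ≤ ∫⁻ x, ENNReal.ofReal (l ^ (1 - p)) * ‖f x‖ₑ ^ p := by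
          refine lintegral_mono fun x => ?_
          by_cases hx : ‖f x‖ ≤ l
          · rw [hv, indicator_of_notMem (by simpa using hx)]
            simp
          · rw [hv, indicator_of_mem (by simpa using hx)]
            rw [not_le] at hx
            have hx0 : 0 < ‖f x‖ := hl.trans hx
            rw [← ofReal_norm, ENNReal.ofReal_rpow_of_pos hx0,
              ← ENNReal.ofReal_mul (Real.rpow_nonneg hl.le _)]
            refine ENNReal.ofReal_le_ofReal ?_
            calc ‖f x‖ = ‖f x‖ ^ (1 - p) * ‖f x‖ ^ p := by
                  rw [← Real.rpow_add hx0]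
                  simp
              _ ≤ l ^ (1 - p) * ‖f x‖ ^ p :=
                  mul_le_mul_of_nonneg_right
                    (Real.rpow_le_rpow_of_nonpos hl hx.le (by linarith))
                    (Real.rpow_nonneg hx0.le _)
      _ ≤ ENNReal.ofReal (l ^ (1 - p)) * ENNReal.ofReal b := by
          rw [lintegral_const_mul _ (hm.enorm.pow_const p)]
          gcongr
      _ ≤ ENNReal.ofReal (α / 2) := by
          rw [← ENNReal.ofReal_mul (Real.rpow_nonneg hl.le _)]
          exact ENNReal.ofReal_le_ofReal (by linarith)
  have hsub : {ξ | α < ‖𝓕 f ξ‖} ⊆ {ξ | ENNReal.ofReal (α / 2) ≤ ‖𝓕 u ξ‖ₑ} := by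
    intro ξ hξ
    have h1 : 𝓕 f ξ = 𝓕 u ξ + 𝓕 v ξ := by
      conv_lhs => rw [huv]
      exact fourier_add_apply hui hvi ξ
    have h2 : ‖𝓕 v ξ‖ ≤ α / 2 := (norm_fourier_le_integral_norm v ξ).trans hvb
    have h3 : α < ‖𝓕 f ξ‖ := hξ
    have h4 := norm_add_le (𝓕 u ξ) (𝓕 v ξ)
    rw [← h1] at h4
    rw [mem_ofPred_eq, ← ofReal_norm]
    exact ENNReal.ofReal_le_ofReal (by linarith)
  have hα2 : ENNReal.ofReal (α / 2) ≠ 0 := by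
    rw [Ne, ENNReal.ofReal_eq_zero, not_le]
    positivity
  refine (measure_mono hsub).trans ?_
  refine (meas_ge_le_mul_pow_eLpNorm_enorm volume (p := 2) (by norm_num) (by norm_num)
    (continuous_fourier hui).aestronglyMeasurable hα2
    (fun h => absurd h ENNReal.ofReal_ne_top)).trans ?_
  rw [eLpNorm_fourier_two hui hu2, ENNReal.toReal_ofNat]
  gcongr
  have h5 := eLpNorm_eq_lintegral_rpow_enorm_toReal (f := u) (μ := volume) (p := 2) (by norm_num)
    (by norm_num)
  rw [h5, ENNReal.toReal_ofNat, ← ENNReal.rpow_mul]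
  norm_num
  refine lintegral_mono fun x => ?_
  by_cases hx : ‖f x‖ ≤ l
  · rw [hu, indicator_of_mem (by exact hx), indicator_of_mem (by exact hx)]
  · rw [hu, indicator_of_notMem (by exact hx), indicator_of_notMem (by exact hx)]
    simp

/-- The weighted integral over the heights `α` whose truncation level is above `x`. -/
theorem lintegral_truncation_le {p p' b : ℝ} (hp : 1 < p) (hp' : 2 < p')
    (hpp' : (p - 1) * (p' - 1) = 1) (hb : 0 < b) {x : ℝ} (hx : 0 ≤ x) :
    ∫⁻ α in Ioi (0 : ℝ), (if x ≤ (α / (2 * b)) ^ (-(p' - 1)) then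
      ENNReal.ofReal (4 * α ^ (p' - 3) * x ^ (2 : ℝ)) else 0) ≤
      ENNReal.ofReal (4 * (2 * b) ^ (p' - 2) / (p' - 2) * x ^ p) := by
  rcases hx.eq_or_lt with rfl | hx
  · simp
  -- Since `(p - 1)(p' - 1) = 1`, solving the truncation condition for `α` gives `α ≤ m`. The
  -- integral over `(0, m]` converges because `p' - 3 > -1`.
  set m : ℝ := 2 * b * x ^ (-(p - 1)) with hm
  have hm0 : 0 < m := by positivity
  calc ∫⁻ α in Ioi (0 : ℝ), (if x ≤ (α / (2 * b)) ^ (-(p' - 1)) then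
      ENNReal.ofReal (4 * α ^ (p' - 3) * x ^ (2 : ℝ)) else 0)
      ≤ ∫⁻ α in Ioi (0 : ℝ), (Iic m).indicator
        (fun α => ENNReal.ofReal (4 * α ^ (p' - 3) * x ^ (2 : ℝ))) α := by
        refine setLIntegral_mono' measurableSet_Ioi fun α hα => ?_
        have hα0 : 0 < α := hα
        split_ifs with h
        · rw [indicator_of_mem]
          have h1 : x ^ (p - 1) ≤ ((α / (2 * b)) ^ (-(p' - 1))) ^ (p - 1) :=
            Real.rpow_le_rpow hx.le h (by linarith)
          rw [← Real.rpow_mul (by positivity), show -(p' - 1) * (p - 1) = -1 by linarith,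
            Real.rpow_neg_one, inv_div, le_div_iff₀ hα0] at h1
          have h2 : 0 < x ^ (p - 1) := Real.rpow_pos_of_pos hx _
          rw [mem_Iic, hm, Real.rpow_neg hx.le, ← div_eq_mul_inv, le_div_iff₀ h2]
          linarith
        · exact zero_le
    _ = ∫⁻ α in Ioc 0 m, ENNReal.ofReal (4 * α ^ (p' - 3) * x ^ (2 : ℝ)) := by
        rw [setLIntegral_indicator measurableSet_Iic, inter_comm, Ioi_inter_Iic]
    _ = ENNReal.ofReal (∫ α in Ioc 0 m, 4 * α ^ (p' - 3) * x ^ (2 : ℝ)) := by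
        rw [ofReal_integral_eq_lintegral_ofReal]
        · have := (intervalIntegral.intervalIntegrable_rpow' (a := 0) (b := m) (r := p' - 3)
            (by linarith))
          rw [intervalIntegrable_iff_integrableOn_Ioc_of_le hm0.le] at this
          exact (this.const_mul 4).mul_const _
        · filter_upwards [ae_restrict_mem measurableSet_Ioc] with α hα
          have : 0 < α := hα.1
          simp only [Pi.zero_apply]
          positivity
    _ = ENNReal.ofReal (4 * (2 * b) ^ (p' - 2) / (p' - 2) * x ^ p) := by
        congr 1
        rw [integral_mul_const, integral_const_mul, ← intervalIntegral.integral_of_le hm0.le,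
          integral_rpow (Or.inl (by linarith)), Real.zero_rpow (by linarith), sub_zero,
          show p' - 3 + 1 = p' - 2 by ring, hm, Real.mul_rpow (by positivity) (by positivity),
          ← Real.rpow_mul hx.le, show p = -(p - 1) * (p' - 2) + 2 by linarith,
          Real.rpow_add hx, show -(-(p - 1) * (p' - 2) + 2 - 1) = -(p - 1) by linarith]
        ring

/-- Layer-cake formula: the distribution function at each height `α` is bounded by truncating `f` at
a level depending on `α`, and Tonelli then lets the integral over `α` be done first. -/
theorem lintegral_fourier_rpow_le {p p' b : ℝ} (hp : 1 < p) (hp' : 2 < p')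
    (hpp' : (p - 1) * (p' - 1) = 1) (hb : 0 < b) {f : ℝ → ℂ} (hm : Measurable f)
    (hf : Integrable f) (hfb : ∫⁻ x, ‖f x‖ₑ ^ p ≤ ENNReal.ofReal b) :
    ∫⁻ ξ, ENNReal.ofReal (‖𝓕 f ξ‖ ^ p') ≤
      ENNReal.ofReal p' * (ENNReal.ofReal (4 * (2 * b) ^ (p' - 2) / (p' - 2)) *
        ENNReal.ofReal b) := by
  rw [lintegral_rpow_eq_lintegral_meas_lt_mul volume (ae_of_all _ fun ξ => norm_nonneg _)
    (continuous_fourier hf).norm.aemeasurable (by linarith)]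
  refine mul_le_mul_right ?_ _
  set K : ℝ → ℝ → ℝ≥0∞ := fun α x => if ‖f x‖ ≤ (α / (2 * b)) ^ (-(p' - 1)) then
      ENNReal.ofReal (4 * α ^ (p' - 3) * ‖f x‖ ^ (2 : ℝ)) else 0 with hK
  have hKm : Measurable (Function.uncurry K) := by
    refine Measurable.ite (measurableSet_le (by fun_prop) (by fun_prop)) ?_ measurable_const
    fun_prop
  calc ∫⁻ α in Ioi (0 : ℝ), volume {ξ | α < ‖𝓕 f ξ‖} * ENNReal.ofReal (α ^ (p' - 1))
      ≤ ∫⁻ α in Ioi (0 : ℝ), ∫⁻ x, K α x := by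
        refine setLIntegral_mono' measurableSet_Ioi fun α hα => ?_
        have hα0 : 0 < α := hα
        -- The level for which `b * l^{1-p}` equals `α / 2`.
        set l : ℝ := (α / (2 * b)) ^ (-(p' - 1)) with hl
        have hl0 : 0 < l := by positivity
        have h1 := measure_lt_norm_fourier_le hm hf hp hfb hα0 hl0 (by
          rw [hl, ← Real.rpow_mul (by positivity), show -(p' - 1) * (1 - p) = 1 by linarith,
            Real.rpow_one]
          field_simp
          rfl)
        refine (mul_le_mul_left h1 _).trans ?_
        rw [mul_right_comm, ← lintegral_const_mul' _ _ (by
          refine ENNReal.mul_ne_top (ENNReal.rpow_ne_top_of_nonneg (by norm_num) ?_)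
            ENNReal.ofReal_ne_top
          simpa using hα0)]
        refine lintegral_mono fun x => ?_
        simp only [hK]
        by_cases hx : ‖f x‖ ≤ l
        · rw [indicator_of_mem (by exact hx), if_pos hx, ← ofReal_norm,
            ENNReal.ofReal_rpow_of_nonneg (norm_nonneg _) (by norm_num),
            ← ENNReal.ofReal_inv_of_pos (by positivity),
            ENNReal.ofReal_rpow_of_nonneg (by positivity) (by norm_num),
            ← ENNReal.ofReal_mul (by positivity), ← ENNReal.ofReal_mul (by positivity)]
          refine ENNReal.ofReal_le_ofReal (le_of_eq ?_)
          congr 1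
          rw [show p' - 1 = p' - 3 + 2 by ring, Real.rpow_add hα0]
          norm_num
          field_simp
          norm_num
        · rw [indicator_of_notMem (by exact hx), if_neg hx, mul_zero]
    _ = ∫⁻ x, ∫⁻ α in Ioi (0 : ℝ), K α x := lintegral_lintegral_swap hKm.aemeasurable
    _ ≤ ∫⁻ x, ENNReal.ofReal (4 * (2 * b) ^ (p' - 2) / (p' - 2)) * ‖f x‖ₑ ^ p := by
        refine lintegral_mono fun x => ?_
        refine (lintegral_truncation_le hp hp' hpp' hb (norm_nonneg (f x))).trans (le_of_eq ?_)
        have : 0 < p' - 2 := by linarith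
        rw [ENNReal.ofReal_mul (by positivity), ← ofReal_norm,
          ENNReal.ofReal_rpow_of_nonneg (norm_nonneg _) (by linarith)]
    _ ≤ _ := by
        rw [lintegral_const_mul _ (hm.enorm.pow_const p)]
        gcongr

/-- A form of the Hausdorff-Young inequality: the Fourier transform maps bounded subsets of
`L¹ ∩ L^p` in the `L^p` norm to bounded subsets of `L^{p'}`. -/
theorem exists_eLpNorm_fourier_le {p p' : ℝ} (hp : 1 < p) (hp2 : p ≤ 2)
    (hpp' : 1 / p + 1 / p' = 1) (hp' : 0 < p') {B : ℝ≥0∞} (hB : B ≠ ∞) :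
    ∃ C : ℝ≥0∞, C ≠ ∞ ∧ ∀ f : ℝ → ℂ, Measurable f → Integrable f →
      eLpNorm f (ENNReal.ofReal p) volume ≤ B → eLpNorm (𝓕 f) (ENNReal.ofReal p') volume ≤ C := by
  have hmul : (p - 1) * (p' - 1) = 1 := by
    field_simp at hpp'
    linarith
  -- The interpolation constant blows up at `p' = 2`, where Plancherel applies directly.
  rcases hp2.eq_or_lt with rfl | hp2
  · have : p' = 2 := by linarith
    subst this
    rw [show ENNReal.ofReal 2 = 2 by simp]
    refine ⟨B, hB, fun f hm hf h => ?_⟩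
    exact (eLpNorm_fourier_two hf ⟨hf.1, h.trans_lt hB.lt_top⟩).trans_le h
  · have hp'2 : 2 < p' := by
      by_contra h
      have : (p - 1) * (p' - 1) < 1 := by nlinarith
      linarith
    have hp0 : ENNReal.ofReal p ≠ 0 := by simp; linarith
    have hp0' : ENNReal.ofReal p' ≠ 0 := by simp; linarith
    -- The added `1` keeps `b` positive when `B = 0`.
    set b : ℝ := (B ^ p).toReal + 1 with hb
    have hb0 : 0 < b := by positivity
    refine ⟨(ENNReal.ofReal p' * (ENNReal.ofReal (4 * (2 * b) ^ (p' - 2) / (p' - 2)) *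
        ENNReal.ofReal b)) ^ (1 / p'), ?_, fun f hm hf h => ?_⟩
    · exact ENNReal.rpow_ne_top_of_nonneg (by positivity) (ENNReal.mul_ne_top ENNReal.ofReal_ne_top
        (ENNReal.mul_ne_top ENNReal.ofReal_ne_top ENNReal.ofReal_ne_top))
    · have hfb : ∫⁻ x, ‖f x‖ₑ ^ p ≤ ENNReal.ofReal b := by
        rw [eLpNorm_eq_lintegral_rpow_enorm_toReal hp0 ENNReal.ofReal_ne_top,
          ENNReal.toReal_ofReal (by linarith), one_div,
          ENNReal.rpow_inv_le_iff (by linarith)] at h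
        refine h.trans ?_
        rw [← ENNReal.ofReal_toReal (ENNReal.rpow_ne_top_of_nonneg (by linarith) hB)]
        exact ENNReal.ofReal_le_ofReal (by linarith)
      rw [eLpNorm_eq_lintegral_rpow_enorm_toReal hp0' ENNReal.ofReal_ne_top,
          ENNReal.toReal_ofReal hp'.le]
      refine ENNReal.rpow_le_rpow ?_ (by positivity)
      refine le_trans (le_of_eq ?_) (lintegral_fourier_rpow_le hp hp'2 hmul hb0 hm hf hfb)
      refine lintegral_congr fun ξ => ?_
      rw [← ofReal_norm, ENNReal.ofReal_rpow_of_nonneg (norm_nonneg _) hp'.le]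

end HausdorffYoung

/-! ### Laplace transforms of functions in `L^{q'}`. -/

section LaplaceTransform

open Topology FourierTransform

variable {q q' : ℝ}

theorem mem_rightHalfPlane {s : ℂ} : s ∈ rightHalfPlane ↔ 0 < s.re := Iff.rfl

theorem isOpen_rightHalfPlane : IsOpen rightHalfPlane :=
  isOpen_lt continuous_const Complex.continuous_re

theorem convex_rightHalfPlane : Convex ℝ rightHalfPlane :=
  convex_halfSpace_re_gt 0

theorem expMonomial_zero_apply (ω : ℂ) (t : ℝ) : expMonomial ω 0 t = Complex.exp (ω * t) := by
  simp [expMonomial]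

theorem integrable_expMonomial_mul (hq : q.HolderConjugate q') {g : ℝ → ℂ}
    (hg : MemLpHalfLine q' g) {ω : ℂ} (hω : ω.re < 0) (j : ℕ) :
    Integrable (fun t => expMonomial ω j t * g t) halfLine := by
  have := hq.ennrealOfReal
  exact (memLpHalfLine_expMonomial hω j hq.pos).integrable_mul hg

theorem integrable_laplace_integrand (hq : q.HolderConjugate q') {g : ℝ → ℂ}
    (hg : MemLpHalfLine q' g) {s : ℂ} (hs : s ∈ rightHalfPlane) :
    Integrable (fun t : ℝ => Complex.exp (-s * t) * g t) halfLine := by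
  have h : (-s).re < 0 := by simpa using mem_rightHalfPlane.1 hs
  simpa only [expMonomial_zero_apply] using integrable_expMonomial_mul hq hg h 0

/-- Differentiation under the integral: on the disc of radius `Re s / 2` the derivative is dominated
by `t e^{-t Re s / 2} ‖g t‖`, integrable by Hölder. -/
theorem analyticOnNhd_laplace (hq : q.HolderConjugate q') {g : ℝ → ℂ}
    (hg : MemLpHalfLine q' g) : AnalyticOnNhd ℂ (laplace g) rightHalfPlane := by
  refine DifferentiableOn.analyticOnNhd (fun s hs => ?_) isOpen_rightHalfPlane
  refine DifferentiableAt.differentiableWithinAt ?_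
  have hs0 : 0 < s.re := hs
  have hε : 0 < s.re / 2 := by linarith
  have hre : ((-(s.re / 2) : ℝ) : ℂ).re < 0 := by
    rw [Complex.ofReal_re]
    linarith
  have hmeas : ∀ z : ℂ, AEStronglyMeasurable (fun t : ℝ => Complex.exp (-z * t)) halfLine :=
    fun z => Continuous.aestronglyMeasurable (by fun_prop)
  refine (hasDerivAt_integral_of_dominated_loc_of_deriv_le (s := Metric.ball s (s.re / 2))
    (F := fun (z : ℂ) (t : ℝ) => Complex.exp (-z * t) * g t)
    (F' := fun (z : ℂ) (t : ℝ) => Complex.exp (-z * t) * -(t : ℂ) * g t)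
    (bound := fun t => ‖expMonomial ((-(s.re / 2) : ℝ) : ℂ) 1 t * g t‖)
    (Metric.ball_mem_nhds s hε) ?_ ?_ ?_ ?_ ?_ ?_).2.differentiableAt
  · exact Eventually.of_forall fun z => (hmeas z).mul hg.1
  · exact integrable_laplace_integrand hq hg hs
  · refine ((hmeas s).mul ?_).mul hg.1
    exact Continuous.aestronglyMeasurable (by fun_prop)
  · filter_upwards [ae_restrict_mem measurableSet_Ioi] with t ht z hz
    have ht0 : 0 < t := ht
    rw [norm_mul, norm_mul, norm_mul, norm_neg, Complex.norm_exp, norm_expMonomial _ _ ht0.le,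
      Complex.norm_of_nonneg ht0.le]
    refine mul_le_mul_of_nonneg_right ?_ (norm_nonneg _)
    have h1 : s.re / 2 ≤ z.re := by
      have h2 := (Complex.abs_re_le_norm (z - s)).trans_lt (mem_ball_iff_norm.1 hz)
      rw [Complex.sub_re] at h2
      have := (abs_lt.1 h2).1
      linarith
    have h3 : (-z * (t : ℂ)).re = -z.re * t := by simp
    rw [h3, mul_comm, Nat.factorial_one, Nat.cast_one, div_one, pow_one, Complex.ofReal_re]
    refine mul_le_mul_of_nonneg_left (Real.exp_le_exp.2 ?_) ht0.le
    nlinarith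
  · exact (integrable_expMonomial_mul hq hg hre 1).norm
  · refine ae_of_all _ fun t z _ => ?_
    have h1 : HasDerivAt (fun z : ℂ => -z * (t : ℂ)) (-(t : ℂ)) z := by
      simpa using (hasDerivAt_id z).neg.mul_const (t : ℂ)
    exact h1.cexp.mul_const _

/-- On a vertical line the Laplace transform is a Fourier transform. -/
theorem fourier_indicator_exp_mul (g : ℝ → ℂ) (x η : ℝ) :
    𝓕 ((Ioi 0).indicator fun t : ℝ => Complex.exp (-x * t) * g t) η =
      laplace g (x + 2 * Real.pi * η * Complex.I) := by
  rw [Real.fourier_real_eq_integral_exp_smul, laplace, halfLine,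
    ← integral_indicator measurableSet_Ioi]
  refine integral_congr_ae (ae_of_all _ fun t => ?_)
  by_cases ht : t ∈ Ioi (0 : ℝ)
  · simp only [indicator_of_mem ht, smul_eq_mul]
    rw [← mul_assoc, ← Complex.exp_add]
    congr 2
    push_cast
    ring
  · simp only [indicator_of_notMem ht, smul_zero]

/-- A function in `L^{q'}` of the half-line is determined by its Laplace transform. -/
theorem ae_eq_of_laplace_eq (hq : q.HolderConjugate q') {g h : ℝ → ℂ}
    (hg : MemLpHalfLine q' g) (hh : MemLpHalfLine q' h)
    (he : ∀ s ∈ rightHalfPlane, laplace g s = laplace h s) : g =ᵐ[halfLine] h := by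
  have h1 : (1 : ℂ) ∈ rightHalfPlane := by simp [rightHalfPlane]
  have hgh : MemLpHalfLine q' (g - h) := MemLp.sub hg hh
  have hint : Integrable ((Ioi 0).indicator
      fun t : ℝ => Complex.exp (-(1 : ℝ) * t) * (g - h) t) := by
    rw [integrable_indicator_iff measurableSet_Ioi]
    simpa [halfLine, IntegrableOn] using integrable_laplace_integrand hq hgh h1
  have h0 := ae_eq_zero_of_fourier_eq_zero hint (fun η => by
    have hs : ((1 : ℝ) + 2 * Real.pi * η * Complex.I : ℂ) ∈ rightHalfPlane := by
      simp [rightHalfPlane]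
    rw [fourier_indicator_exp_mul]
    have : laplace (g - h) ((1 : ℝ) + 2 * Real.pi * η * Complex.I) =
        laplace g ((1 : ℝ) + 2 * Real.pi * η * Complex.I) -
        laplace h ((1 : ℝ) + 2 * Real.pi * η * Complex.I) := by
      simp only [laplace, Pi.sub_apply, mul_sub]
      exact integral_sub (integrable_laplace_integrand hq hg hs)
        (integrable_laplace_integrand hq hh hs)
    rw [this, he _ hs, sub_self])
  rw [EventuallyEq, halfLine, ae_restrict_iff' measurableSet_Ioi]
  filter_upwards [h0] with t ht0 ht
  rw [indicator_of_mem ht] at ht0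
  simpa [sub_eq_zero] using ht0

theorem laplace_add (hq : q.HolderConjugate q') {g h : ℝ → ℂ}
    (hg : MemLpHalfLine q' g) (hh : MemLpHalfLine q' h) {s : ℂ} (hs : s ∈ rightHalfPlane) :
    laplace (g + h) s = laplace g s + laplace h s := by
  simp only [laplace, Pi.add_apply, mul_add]
  exact integral_add (integrable_laplace_integrand hq hg hs)
    (integrable_laplace_integrand hq hh hs)

end LaplaceTransform

/-! ### Cancelling `f` despite its zeros. -/

section Cancellation

open Topology

variable {D : Set ℂ} {f : ℂ → ℂ}

theorem eventually_nhdsNE_ne_zero (hDc : IsConnected D) (hf : AnalyticOnNhd ℂ f D)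
    (hf0 : ∃ s ∈ D, f s ≠ 0) {s : ℂ} (hs : s ∈ D) : ∀ᶠ z in 𝓝[≠] s, f z ≠ 0 := by
  by_contra h
  obtain ⟨z, hz, hfz⟩ := hf0
  refine hfz (hf.eqOn_zero_of_preconnected_of_frequently_eq_zero hDc.isPreconnected hs ?_ hz)
  intro h'
  exact h (by simpa using h')

/-- A function which is analytic and not identically zero can be cancelled. -/
theorem eq_of_mul_eq (hDc : IsConnected D) (hf : AnalyticOnNhd ℂ f D)
    (hf0 : ∃ s ∈ D, f s ≠ 0) {U : Set ℂ} (hU : IsOpen U) (hUD : U ⊆ D) {A B : ℂ → ℂ}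
    (hA : ContinuousOn A U) (hB : ContinuousOn B U) (h : ∀ s ∈ U, f s * A s = f s * B s)
    {s : ℂ} (hs : s ∈ U) : A s = B s := by
  have hUs := hU.mem_nhds hs
  have h1 : A =ᶠ[𝓝[≠] s] B := by
    filter_upwards [eventually_nhdsNE_ne_zero hDc hf hf0 (hUD hs), nhdsWithin_le_nhds hUs]
      with z hz hzU
    exact mul_left_cancel₀ hz (h z hzU)
  exact ((hA.continuousAt hUs).eventuallyEq_nhds_iff_eventuallyEq_nhdsNE
    (hB.continuousAt hUs)).1 h1 |>.eq_of_nhds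

/-- Zeros of `f` are isolated, so they meet the line in a set with codiscrete complement, which is
null. -/
theorem ae_vertical_line_ne_zero (hDc : IsConnected D) (hf : AnalyticOnNhd ℂ f D)
    (hf0 : ∃ s ∈ D, f s ≠ 0) (hD : rightHalfPlane ⊆ D) {σ : ℝ} (hσ : 0 < σ) :
    ∀ᵐ y : ℝ, f ((σ : ℂ) + (y : ℂ) * Complex.I) ≠ 0 := by
  have h : {y : ℝ | f ((σ : ℂ) + (y : ℂ) * Complex.I) ≠ 0} ∈ codiscreteWithin (univ : Set ℝ) := by
    rw [mem_codiscreteWithin_iff_forall_mem_nhdsNE]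
    intro y _
    rw [compl_univ, union_empty]
    have hs : (σ : ℂ) + (y : ℂ) * Complex.I ∈ D := hD (by simpa [rightHalfPlane] using hσ)
    have hc : Tendsto (fun y : ℝ => (σ : ℂ) + (y : ℂ) * Complex.I) (𝓝[≠] y)
        (𝓝[≠] ((σ : ℂ) + (y : ℂ) * Complex.I)) := by
      refine tendsto_nhdsWithin_of_tendsto_nhds_of_eventually_within _ ?_ ?_
      · exact (Continuous.tendsto (by fun_prop) y).mono_left nhdsWithin_le_nhds
      · filter_upwards [self_mem_nhdsWithin] with z hz hzy
        apply hz
        simpa using hzy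
    exact hc.eventually (eventually_nhdsNE_ne_zero hDc hf hf0 hs)
  have := ae_restrict_le_codiscreteWithin (μ := volume) MeasurableSet.univ h
  rwa [Measure.restrict_univ] at this

end Cancellation

/-! ### Moving vertical contours. -/

section ContourShift

open Topology

/-- The integral of an analytic function over a vertical line does not depend on the line, if the
integrals of its absolute value are locally bounded. -/
theorem integral_vertical_eq {Φ : ℂ → ℂ} (hΦ : DifferentiableOn ℂ Φ rightHalfPlane) {x₁ x₂ A : ℝ}
    (h1 : 0 < x₁) (h12 : x₁ ≤ x₂)
    (hint : ∀ x ∈ Icc x₁ x₂, Integrable fun y : ℝ => Φ (x + y * Complex.I))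
    (hA : ∀ x ∈ Icc x₁ x₂, ∫ y : ℝ, ‖Φ (x + y * Complex.I)‖ ≤ A) :
    ∫ y : ℝ, Φ (x₁ + y * Complex.I) = ∫ y : ℝ, Φ (x₂ + y * Complex.I) := by
  set u : ℝ × ℝ → ℂ := fun z => Φ (z.1 + z.2 * Complex.I) with hu
  set μ : Measure ℝ := volume.restrict (Ioc x₁ x₂) with hμ
  have hum : AEStronglyMeasurable u (μ.prod volume) := by
    have : μ.prod (volume : Measure ℝ) = (volume.prod volume).restrict (Ioc x₁ x₂ ×ˢ univ) := by
      rw [← Measure.prod_restrict, Measure.restrict_univ]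
    rw [this]
    refine ContinuousOn.aestronglyMeasurable ?_ (measurableSet_Ioc.prod MeasurableSet.univ)
    refine hΦ.continuousOn.comp (Continuous.continuousOn (by fun_prop)) fun z hz => ?_
    rw [mem_rightHalfPlane]
    simpa using h1.trans hz.1.1
  have hui : Integrable u (μ.prod volume) := by
    rw [integrable_prod_iff hum]
    refine ⟨?_, ?_⟩
    · filter_upwards [ae_restrict_mem measurableSet_Ioc] with x hx
        using hint x (Ioc_subset_Icc_self hx)
    · refine Integrable.mono' (integrable_const A) hum.norm.integral_prod_right' ?_
      filter_upwards [ae_restrict_mem measurableSet_Ioc] with x hx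
      rw [Real.norm_of_nonneg (integral_nonneg fun _ => norm_nonneg _)]
      exact hA x (Ioc_subset_Icc_self hx)
  set h : ℝ → ℝ := fun y => ∫ x in x₁..x₂, ‖Φ (x + y * Complex.I)‖ with hh
  have hhi : Integrable h := by
    simp only [hh, intervalIntegral.integral_of_le h12]
    exact hui.norm.integral_prod_right
  have hH : Integrable fun T => h T + h (-T) := hhi.add hhi.comp_neg
  -- By Cauchy's theorem on rectangles, a discrepancy `δ` would keep the horizontal contributions `h
  -- T + h (-T)` above `δ / 2` for all large `T`. That is impossible because `h` is integrable by
  -- Fubini.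
  by_contra hne
  set δ : ℝ := ‖(∫ y : ℝ, Φ (x₁ + y * Complex.I)) - ∫ y : ℝ, Φ (x₂ + y * Complex.I)‖ with hδ
  have hδ0 : 0 < δ := norm_pos_iff.2 (sub_ne_zero.2 hne)
  have hlim : Tendsto (fun T : ℝ => ‖(∫ y in -T..T, Φ (x₁ + y * Complex.I)) -
      ∫ y in -T..T, Φ (x₂ + y * Complex.I)‖) atTop (𝓝 δ) :=
    ((intervalIntegral_tendsto_integral (hint x₁ (left_mem_Icc.2 h12)) tendsto_neg_atTop_atBot
      tendsto_id).sub (intervalIntegral_tendsto_integral (hint x₂ (right_mem_Icc.2 h12))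
      tendsto_neg_atTop_atBot tendsto_id)).norm
  have hrect : ∀ T : ℝ, ‖(∫ y in -T..T, Φ (x₁ + y * Complex.I)) -
      ∫ y in -T..T, Φ (x₂ + y * Complex.I)‖ ≤ h T + h (-T) := by
    intro T
    have hr := Complex.integral_boundary_rect_eq_zero_of_differentiableOn Φ
      (x₁ + (-T : ℝ) * Complex.I) (x₂ + T * Complex.I) (hΦ.mono fun z hz => by
        have hz1 := hz.1
        simp only [mem_preimage, Complex.add_re, Complex.ofReal_re, Complex.mul_re, Complex.I_re,
          mul_zero, Complex.ofReal_im, Complex.I_im, mul_one, sub_self, add_zero,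
          uIcc_of_le h12] at hz1
        exact h1.trans_le hz1.1)
    simp only [Complex.add_re, Complex.ofReal_re, Complex.mul_re, Complex.I_re,
      mul_zero, Complex.ofReal_im, Complex.I_im, mul_one, sub_self, add_zero, Complex.add_im,
      Complex.mul_im, zero_add] at hr
    have hr' : (∫ y in -T..T, Φ (x₁ + y * Complex.I)) - (∫ y in -T..T, Φ (x₂ + y * Complex.I)) =
        Complex.I * ((∫ x in x₁..x₂, Φ (x + T * Complex.I)) -
          ∫ x in x₁..x₂, Φ (x + (-T : ℝ) * Complex.I)) := by
      simp only [smul_eq_mul] at hr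
      linear_combination Complex.I * hr - ((∫ y in -T..T, Φ (x₂ + y * Complex.I)) -
        ∫ y in -T..T, Φ (x₁ + y * Complex.I)) * Complex.I_mul_I
    rw [hr', norm_mul, Complex.norm_I, one_mul]
    exact (norm_sub_le _ _).trans (add_le_add
      (intervalIntegral.norm_integral_le_integral_norm h12)
      (intervalIntegral.norm_integral_le_integral_norm h12))
  have hev : ∀ᶠ T in atTop, δ / 2 ≤ ‖h T + h (-T)‖ := by
    filter_upwards [hlim.eventually (eventually_gt_nhds (half_lt_self hδ0))] with T hT
    exact (hT.le.trans (hrect T)).trans (Real.le_norm_self _)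
  obtain ⟨T₀, hT₀⟩ := eventually_atTop.1 hev
  have hfin := hH.measure_norm_ge_lt_top (half_pos hδ0)
  have : volume (Ici T₀) < ∞ := (measure_mono fun T hT => hT₀ T hT).trans_lt hfin
  rw [Real.volume_Ici] at this
  exact lt_irrefl _ this

end ContourShift

/-! ### Hardy means as `L^q` norms; Bromwich integrals. -/

section VerticalLines

open Topology FourierTransform

/-- The restriction of `F` to the line `Re s = x`, in the scale of the Fourier transform. -/
noncomputable def onVertical (F : ℂ → ℂ) (x η : ℝ) : ℂ :=
  F ((x : ℂ) + 2 * Real.pi * η * Complex.I)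

theorem vertical_mem {x : ℝ} (hx : 0 < x) (η : ℝ) :
    (x : ℂ) + 2 * Real.pi * η * Complex.I ∈ rightHalfPlane := by
  rw [mem_rightHalfPlane]
  simpa using hx

theorem continuous_onVertical {F : ℂ → ℂ} (hF : ContinuousOn F rightHalfPlane) {x : ℝ}
    (hx : 0 < x) : Continuous (onVertical F x) :=
  hF.comp_continuous (by fun_prop) (vertical_mem hx)

theorem onVertical_eq (F : ℂ → ℂ) (x η : ℝ) :
    onVertical F x η = F ((x : ℂ) + ((2 * Real.pi * η : ℝ) : ℂ) * Complex.I) := by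
  rw [onVertical]
  push_cast
  rfl

theorem integrable_onVertical_iff (F : ℂ → ℂ) (x : ℝ) :
    Integrable (onVertical F x) ↔ Integrable fun y : ℝ => F (x + y * Complex.I) := by
  have h : onVertical F x = fun η => (fun y : ℝ => F (x + y * Complex.I)) (2 * Real.pi * η) :=
    funext fun η => onVertical_eq F x η
  rw [h]
  exact integrable_comp_mul_left_iff (fun y : ℝ => F (x + y * Complex.I)) Real.two_pi_pos.ne'

theorem integral_onVertical {E : Type*} [NormedAddCommGroup E] [NormedSpace ℝ E] (v : ℂ → E)
    (x : ℝ) : ∫ η : ℝ, v ((x : ℂ) + 2 * Real.pi * η * Complex.I) =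
      (2 * Real.pi)⁻¹ • ∫ y : ℝ, v (x + y * Complex.I) := by
  have h := Measure.integral_comp_mul_left (fun y : ℝ => v (x + y * Complex.I)) (2 * Real.pi)
  rw [abs_of_pos (inv_pos.2 Real.two_pi_pos)] at h
  rw [← h]
  push_cast
  rfl

/-- The normalization `1/2π` is exactly the Jacobian of `y = 2πη`. -/
theorem hardyMean_eq_eLpNorm {q : ℝ} (hq : 0 < q) (F : ℂ → ℂ) (x : ℝ) :
    hardyMean q F x = eLpNorm (onVertical F x) (ENNReal.ofReal q) volume := by
  rw [eLpNorm_eq_lintegral_rpow_enorm_toReal (by simpa using hq) ENNReal.ofReal_ne_top,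
    ENNReal.toReal_ofReal hq.le, hardyMean]
  congr 1
  have hpi : (2 * Real.pi : ℝ) ≠ 0 := Real.two_pi_pos.ne'
  have h1 := Real.map_volume_mul_left hpi
  have h2 := lintegral_map_equiv (μ := volume)
    (fun y : ℝ => ‖F ((x : ℂ) + (y : ℂ) * Complex.I)‖ₑ ^ q)
    (Homeomorph.mulLeft₀ (2 * Real.pi) hpi).toMeasurableEquiv
  rw [show (⇑(Homeomorph.mulLeft₀ (2 * Real.pi) hpi).toMeasurableEquiv : ℝ → ℝ) =
    (fun y => 2 * Real.pi * y) from rfl, h1, lintegral_smul_measure,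
    abs_of_pos (inv_pos.2 Real.two_pi_pos)] at h2
  rw [one_div, ← smul_eq_mul, h2]
  simp only [onVertical_eq]

theorem memHardy_iff {q : ℝ} (hq : 0 < q) {F : ℂ → ℂ} :
    MemHardy q F ↔ AnalyticOnNhd ℂ F rightHalfPlane ∧ ∃ C : ℝ≥0∞, C ≠ ∞ ∧
      ∀ x : ℝ, 0 < x → eLpNorm (onVertical F x) (ENNReal.ofReal q) volume ≤ C := by
  simp only [MemHardy, hardyMean_eq_eLpNorm hq]

theorem MemHardy.congr {q : ℝ} (hq : 0 < q) {F G : ℂ → ℂ} (hF : MemHardy q F)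
    (h : EqOn F G rightHalfPlane) : MemHardy q G := by
  rw [memHardy_iff hq] at hF ⊢
  obtain ⟨hFa, C, hC, hb⟩ := hF
  refine ⟨hFa.congr isOpen_rightHalfPlane h, C, hC, fun x hx => ?_⟩
  have : onVertical G x = onVertical F x := funext fun η => (h (vertical_mem hx η)).symm
  rw [this]
  exact hb x hx

theorem MemHardy.add {q : ℝ} (hq : 1 ≤ q) {F G : ℂ → ℂ} (hF : MemHardy q F)
    (hG : MemHardy q G) : MemHardy q (F + G) := by
  have hq0 : 0 < q := by linarith
  rw [memHardy_iff hq0] at hF hG ⊢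
  obtain ⟨hFa, C, hC, hFb⟩ := hF
  obtain ⟨hGa, C', hC', hGb⟩ := hG
  refine ⟨hFa.add hGa, C + C', ENNReal.add_ne_top.2 ⟨hC, hC'⟩, fun x hx => ?_⟩
  have hadd : onVertical (F + G) x = onVertical F x + onVertical G x := rfl
  rw [hadd]
  refine (eLpNorm_add_le (continuous_onVertical hFa.continuousOn hx).aestronglyMeasurable
    (continuous_onVertical hGa.continuousOn hx).aestronglyMeasurable
    (by simpa using hq)).trans (add_le_add (hFb x hx) (hGb x hx))

/-- The function `t ↦ (1/2πi) ∫ e^{st} F(s) ds`, the integral being over the line `Re s = x`. -/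
noncomputable def bromwich (F : ℂ → ℂ) (x t : ℝ) : ℂ :=
  Complex.exp (x * t) * 𝓕⁻ (onVertical F x) t

theorem norm_fourierInv_le_integral_norm (f : ℝ → ℂ) (t : ℝ) : ‖𝓕⁻ f t‖ ≤ ∫ x, ‖f x‖ := by
  rw [Real.fourierInv_eq_fourier_neg]
  exact norm_fourier_le_integral_norm f _

theorem continuous_fourierInv {f : ℝ → ℂ} (hf : Integrable f) : Continuous (𝓕⁻ f) := by
  have : 𝓕⁻ f = fun t => 𝓕 f (-t) := funext (Real.fourierInv_eq_fourier_neg f)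
  rw [this]
  exact (continuous_fourier hf).comp continuous_neg

theorem continuous_bromwich {F : ℂ → ℂ} {x : ℝ} (hF : Integrable (onVertical F x)) :
    Continuous (bromwich F x) := by
  have := continuous_fourierInv hF
  unfold bromwich
  fun_prop

theorem norm_bromwich_le (F : ℂ → ℂ) (x t : ℝ) :
    ‖bromwich F x t‖ ≤ Real.exp (x * t) * ∫ η, ‖onVertical F x η‖ := by
  rw [bromwich, norm_mul, Complex.norm_exp]
  have : ((x : ℂ) * t).re = x * t := by simp
  rw [this]
  exact mul_le_mul_of_nonneg_left (norm_fourierInv_le_integral_norm _ _) (Real.exp_pos _).le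

theorem bromwich_eq_integral (F : ℂ → ℂ) (x t : ℝ) :
    bromwich F x t = (2 * Real.pi)⁻¹ • ∫ y : ℝ, Complex.exp ((x + y * Complex.I) * t) *
      F (x + y * Complex.I) := by
  rw [← integral_onVertical (fun s => Complex.exp (s * t) * F s), bromwich, Real.fourierInv_eq',
    ← integral_const_mul]
  refine integral_congr_ae (ae_of_all _ fun η => ?_)
  simp only [smul_eq_mul, onVertical]
  rw [← mul_assoc, ← Complex.exp_add]
  congr 2
  simp
  ring

end VerticalLines

/-! ### Bromwich inversion under uniform `L¹` bounds. -/

section BromwichL1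

open Topology FourierTransform

variable {F : ℂ → ℂ} {A : ℝ}

/-- The contour shift applies to `e^{st} F(s)`, since the modulus of the exponential is monotone in
`Re s` and so is bounded between the two lines by its endpoint values. -/
theorem bromwich_eq_bromwich (hF : AnalyticOnNhd ℂ F rightHalfPlane)
    (hi : ∀ x, 0 < x → Integrable (onVertical F x))
    (hA : ∀ x, 0 < x → ∫ η, ‖onVertical F x η‖ ≤ A) {x₁ x₂ : ℝ} (h1 : 0 < x₁) (h2 : 0 < x₂)
    (t : ℝ) : bromwich F x₁ t = bromwich F x₂ t := by
  wlog h12 : x₁ ≤ x₂ generalizing x₁ x₂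
  · exact (this h2 h1 (le_of_not_ge h12)).symm
  rw [bromwich_eq_integral, bromwich_eq_integral]
  congr 1
  have hre : ∀ x y : ℝ, (((x : ℂ) + y * Complex.I) * t).re = x * t := by
    intro x y
    simp
  have hAy : ∀ x : ℝ, 0 < x → ∫ y : ℝ, ‖F (x + y * Complex.I)‖ ≤ 2 * Real.pi * A := by
    intro x hx
    have h3 := hA x hx
    simp only [onVertical] at h3
    rw [integral_onVertical (fun s => ‖F s‖), smul_eq_mul, inv_mul_le_iff₀ Real.two_pi_pos] at h3
    exact h3
  refine integral_vertical_eq (Φ := fun s => Complex.exp (s * t) * F s)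
    (A := max (Real.exp (x₁ * t)) (Real.exp (x₂ * t)) * (2 * Real.pi * A)) ?_ h1 h12 ?_ ?_
  · exact DifferentiableOn.mul (by fun_prop) hF.differentiableOn
  · intro x hx
    have hx0 : 0 < x := h1.trans_le hx.1
    refine Integrable.bdd_mul (c := Real.exp (x * t)) ((integrable_onVertical_iff F x).1 (hi x hx0))
      (Continuous.aestronglyMeasurable (by fun_prop)) (ae_of_all _ fun y => ?_)
    rw [Complex.norm_exp, hre]
  · intro x hx
    have hx0 : 0 < x := h1.trans_le hx.1
    simp only [norm_mul, Complex.norm_exp, hre]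
    rw [integral_const_mul]
    refine mul_le_mul ?_ (hAy x hx0) (integral_nonneg fun _ => norm_nonneg _)
      (le_max_of_le_left (Real.exp_pos _).le)
    rcases le_total 0 t with ht | ht
    · exact le_max_of_le_right (Real.exp_le_exp.2 (mul_le_mul_of_nonneg_right hx.2 ht))
    · exact le_max_of_le_left (Real.exp_le_exp.2 (mul_le_mul_of_nonpos_right hx.1 ht))

theorem norm_bromwich_le_exp (hF : AnalyticOnNhd ℂ F rightHalfPlane)
    (hi : ∀ x, 0 < x → Integrable (onVertical F x))
    (hA : ∀ x, 0 < x → ∫ η, ‖onVertical F x η‖ ≤ A) {x x' : ℝ} (hx : 0 < x) (hx' : 0 < x')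
    (t : ℝ) : ‖bromwich F x t‖ ≤ Real.exp (x' * t) * A := by
  rw [bromwich_eq_bromwich hF hi hA hx hx']
  exact (norm_bromwich_le F x' t).trans
    (mul_le_mul_of_nonneg_left (hA x' hx') (Real.exp_pos _).le)

/-- The line can be pushed to `+∞`, where `e^{x' t} A` tends to zero. -/
theorem bromwich_eq_zero_of_neg (hF : AnalyticOnNhd ℂ F rightHalfPlane)
    (hi : ∀ x, 0 < x → Integrable (onVertical F x))
    (hA : ∀ x, 0 < x → ∫ η, ‖onVertical F x η‖ ≤ A) {x t : ℝ} (hx : 0 < x) (ht : t < 0) :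
    bromwich F x t = 0 := by
  have h1 : Tendsto (fun x' : ℝ => Real.exp (x' * t) * A) atTop (𝓝 0) := by
    have := (Real.tendsto_exp_atBot.comp (tendsto_id.atTop_mul_const_of_neg ht)).mul_const A
    simpa using this
  have h2 : ‖bromwich F x t‖ ≤ 0 := by
    refine ge_of_tendsto h1 ?_
    filter_upwards [eventually_gt_atTop 0] with x' hx'
    exact norm_bromwich_le_exp hF hi hA hx hx' t
  exact norm_le_zero_iff.1 h2

theorem exp_neg_mul_bromwich (F : ℂ → ℂ) (x t : ℝ) :
    Complex.exp (-x * t) * bromwich F x t = 𝓕⁻ (onVertical F x) t := by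
  rw [bromwich, ← mul_assoc, ← Complex.exp_add]
  simp

/-- On the line through `s`, the damped Bromwich integral is an inverse Fourier transform supported
in `t ≥ 0`. The Laplace integral is thus a full Fourier transform, and inversion applies. -/
theorem laplace_bromwich (hF : AnalyticOnNhd ℂ F rightHalfPlane)
    (hi : ∀ x, 0 < x → Integrable (onVertical F x))
    (hA : ∀ x, 0 < x → ∫ η, ‖onVertical F x η‖ ≤ A) {x : ℝ} (hx : 0 < x) {s : ℂ}
    (hs : s ∈ rightHalfPlane) : laplace (bromwich F x) s = F s := by
  have hs0 : 0 < s.re := hs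
  have hbe : bromwich F x = bromwich F s.re :=
    funext fun t => bromwich_eq_bromwich hF hi hA hx hs0 t
  have hseq : (s.re : ℂ) + 2 * Real.pi * (s.im / (2 * Real.pi) : ℝ) * Complex.I = s := by
    push_cast
    rw [mul_div_cancel₀ _ (by simp)]
    exact Complex.re_add_im s
  have h1 := fourier_indicator_exp_mul (bromwich F s.re) s.re (s.im / (2 * Real.pi))
  rw [hseq, ← hbe] at h1
  rw [← h1, hbe]
  set v : ℝ → ℂ := 𝓕⁻ (onVertical F s.re) with hv
  have hae : ((Ioi 0).indicator fun t : ℝ => Complex.exp (-s.re * t) * bromwich F s.re t)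
      =ᵐ[volume] v := by
    have h0 : ∀ᵐ t : ℝ, t ≠ 0 := Measure.ae_ne volume 0
    filter_upwards [h0] with t ht
    simp only [exp_neg_mul_bromwich]
    rcases ht.lt_or_gt with hneg | hpos
    · rw [indicator_of_notMem (by simp [hneg.le]), hv, ← exp_neg_mul_bromwich,
        bromwich_eq_zero_of_neg hF hi hA hs0 hneg, mul_zero]
    · rw [indicator_of_mem (by exact hpos)]
  have hvc : Continuous v := continuous_fourierInv (hi _ hs0)
  -- Moving to the line of abscissa `Re s / 2` bounds the integrand by a multiple of `e^{-t Re s /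
  -- 2}`.
  have hvi : Integrable v := by
    refine Integrable.congr ?_ hae
    rw [integrable_indicator_iff measurableSet_Ioi]
    have hre : ((-(s.re / 2) : ℝ) : ℂ).re < 0 := by
      rw [Complex.ofReal_re]
      linarith
    refine Integrable.mono' ((integrable_expMonomial hre 0).norm.mul_const A) ?_ ?_
    · simp only [exp_neg_mul_bromwich]
      exact hvc.aestronglyMeasurable
    · filter_upwards [ae_restrict_mem measurableSet_Ioi] with t ht
      have ht0 : 0 < t := ht
      rw [norm_mul, Complex.norm_exp, norm_expMonomial _ _ ht0.le]
      have hr : (-(s.re : ℂ) * t).re = -s.re * t := by simp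
      rw [hr]
      refine (mul_le_mul_of_nonneg_left (norm_bromwich_le_exp hF hi hA hs0
        (half_pos hs0) t) (Real.exp_pos _).le).trans (le_of_eq ?_)
      rw [← mul_assoc, ← Real.exp_add, Complex.ofReal_re]
      simp only [pow_zero, Nat.factorial_zero, Nat.cast_one, div_one, one_mul]
      congr 2
      ring
  rw [Real.fourier_congr_ae hae]
  have hfi : Integrable (𝓕 (onVertical F s.re)) := by
    have : 𝓕 (onVertical F s.re) = fun t => v (-t) := by
      funext t
      rw [hv, Real.fourierInv_eq_fourier_neg, neg_neg]
    rw [this]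
    exact hvi.comp_neg
  rw [hv, Continuous.fourier_fourierInv_eq (continuous_onVertical hF.continuousOn hs0)
    (hi _ hs0) hfi, onVertical, hseq]

/-- Multiplied by `e^{-x' t}`, the Bromwich integral is a reflected Fourier transform of the
restriction to the line `x'`; the uniform bound passes to the limit `x' → 0` by lower semicontinuity
of the norm. -/
theorem eLpNorm_bromwich_le (hF : AnalyticOnNhd ℂ F rightHalfPlane)
    (hi : ∀ x, 0 < x → Integrable (onVertical F x))
    (hA : ∀ x, 0 < x → ∫ η, ‖onVertical F x η‖ ≤ A) {x : ℝ} (hx : 0 < x) {q : ℝ≥0∞} {C : ℝ≥0∞}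
    (hC : ∀ x, 0 < x → eLpNorm (𝓕 (onVertical F x)) q volume ≤ C) :
    eLpNorm (bromwich F x) q halfLine ≤ C := by
  have hcont := continuous_bromwich (hi x hx)
  refine Lp.eLpNorm_le_of_ae_tendsto (u := 𝓝[>] (0 : ℝ))
    (f := fun (x' : ℝ) (t : ℝ) => Complex.exp (-x' * t) * bromwich F x t) ?_ ?_ ?_
  · filter_upwards [self_mem_nhdsWithin] with x' hx'
    have h1 : (fun t : ℝ => Complex.exp (-x' * t) * bromwich F x t) =
        𝓕 (onVertical F x') ∘ Neg.neg := by
      funext t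
      rw [bromwich_eq_bromwich hF hi hA hx hx', exp_neg_mul_bromwich,
        Real.fourierInv_eq_fourier_neg, Function.comp_apply]
    rw [h1]
    refine (eLpNorm_mono_measure _ Measure.restrict_le_self).trans ?_
    rw [eLpNorm_comp_measurePreserving (continuous_fourier (hi x' hx')).aestronglyMeasurable
      (Measure.measurePreserving_neg volume)]
    exact hC x' hx'
  · intro x'
    exact Continuous.aestronglyMeasurable (by fun_prop)
  · refine ae_of_all _ fun t => ?_
    have h2 : Continuous fun x' : ℝ => Complex.exp (-x' * t) * bromwich F x t := by fun_prop
    have h3 := h2.tendsto 0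
    simp only [Complex.ofReal_zero, neg_zero, zero_mul, Complex.exp_zero, one_mul] at h3
    exact h3.mono_left nhdsWithin_le_nhds

end BromwichL1

/-! ### Damping functions in `H^p` into uniformly integrable ones. -/

section Damping

open Topology

/-- The function `F` damped at infinity by the factor `1 / (1 + ε s)²`. -/
noncomputable def damp (ε : ℝ) (F : ℂ → ℂ) (s : ℂ) : ℂ := ((1 + ε * s) ^ 2)⁻¹ * F s

theorem damp_denominator_ne_zero {ε : ℝ} (hε : 0 ≤ ε) {s : ℂ} (hs : s ∈ rightHalfPlane) :
    (1 + ε * s) ^ 2 ≠ 0 := by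
  refine pow_ne_zero _ fun h => ?_
  have h1 := congrArg Complex.re h
  have hs0 : 0 < s.re := hs
  simp only [Complex.add_re, Complex.one_re, Complex.re_ofReal_mul, Complex.zero_re] at h1
  nlinarith

theorem analyticOnNhd_damp {ε : ℝ} (hε : 0 ≤ ε) {F : ℂ → ℂ}
    (hF : AnalyticOnNhd ℂ F rightHalfPlane) : AnalyticOnNhd ℂ (damp ε F) rightHalfPlane := by
  intro s hs
  refine AnalyticAt.mul (AnalyticAt.inv (by fun_prop) (damp_denominator_ne_zero hε hs)) (hF s hs)

theorem norm_damp_factor_le {ε : ℝ} (hε : 0 ≤ ε) {s : ℂ} (hs : s ∈ rightHalfPlane) :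
    ‖((1 + ε * s) ^ 2)⁻¹‖ ≤ (1 + (ε * s.im) ^ 2)⁻¹ := by
  rw [norm_inv, norm_pow]
  refine inv_anti₀ (by positivity) ?_
  rw [Complex.sq_norm, Complex.normSq_apply]
  have hs0 : 0 < s.re := hs
  simp only [Complex.add_re, Complex.one_re, Complex.re_ofReal_mul, Complex.add_im,
    Complex.one_im, Complex.im_ofReal_mul, zero_add]
  nlinarith [mul_nonneg hε hs0.le]

theorem norm_damp_le {ε : ℝ} (hε : 0 ≤ ε) {F : ℂ → ℂ} {s : ℂ} (hs : s ∈ rightHalfPlane) :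
    ‖damp ε F s‖ ≤ ‖F s‖ := by
  rw [damp, norm_mul]
  refine mul_le_of_le_one_left (norm_nonneg _) ((norm_damp_factor_le hε hs).trans ?_)
  exact inv_le_one_of_one_le₀ (by nlinarith [sq_nonneg (ε * s.im)])

theorem memLp_inv_one_add_sq {q : ℝ} (hq : 1 ≤ q) {a : ℝ} (ha : a ≠ 0) :
    MemLp (fun η : ℝ => (1 + (a * η) ^ 2)⁻¹) (ENNReal.ofReal q) volume := by
  have hq0 : 0 < q := by linarith
  have hc : Continuous fun η : ℝ => (1 + (a * η) ^ 2)⁻¹ := by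
    refine Continuous.inv₀ (by fun_prop) fun η => ?_
    positivity
  refine (integrable_norm_rpow_iff hc.aestronglyMeasurable (by simpa using hq0)
    ENNReal.ofReal_ne_top).1 ?_
  rw [ENNReal.toReal_ofReal hq0.le]
  have hi : Integrable fun η : ℝ => (1 + (a * η) ^ 2)⁻¹ :=
    integrable_inv_one_add_sq.comp_mul_left' ha
  refine Integrable.mono' hi (hc.norm.rpow_const fun _ => Or.inr hq0.le).aestronglyMeasurable
    (ae_of_all _ fun η => ?_)
  have h0 : 0 ≤ (1 + (a * η) ^ 2)⁻¹ := by positivity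
  have h1 : (1 + (a * η) ^ 2)⁻¹ ≤ 1 := inv_le_one_of_one_le₀ (by nlinarith [sq_nonneg (a * η)])
  rw [Real.norm_of_nonneg h0, Real.norm_of_nonneg (Real.rpow_nonneg h0 _)]
  exact Real.rpow_le_self_of_le_one h0 h1 hq

/-- Hölder: the damping factor is dominated by a single `L^{p'}` function of the height, the same
for all vertical lines. -/
theorem exists_integral_onVertical_damp_le {p p' : ℝ} (hpq : p.HolderConjugate p') {ε : ℝ}
    (hε : 0 < ε) {F : ℂ → ℂ} (hF : MemHardy p F) :
    ∃ A : ℝ, ∀ x, 0 < x → Integrable (onVertical (damp ε F) x) ∧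
      ∫ η, ‖onVertical (damp ε F) x η‖ ≤ A := by
  obtain ⟨hFa, B, hB, hb⟩ := (memHardy_iff hpq.pos).1 hF
  have := hpq.symm.ennrealOfReal
  set k : ℝ → ℝ := fun η => (1 + (ε * (2 * Real.pi) * η) ^ 2)⁻¹ with hk
  have hkm : MemLp k (ENNReal.ofReal p') volume :=
    memLp_inv_one_add_sq hpq.symm.lt.le (mul_pos hε Real.two_pi_pos).ne'
  have hBk : eLpNorm k (ENNReal.ofReal p') volume * B ≠ ∞ := ENNReal.mul_ne_top hkm.2.ne hB
  refine ⟨(eLpNorm k (ENNReal.ofReal p') volume * B).toReal, fun x hx => ?_⟩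
  have hc := continuous_onVertical (analyticOnNhd_damp hε.le hFa).continuousOn hx
  have hle : eLpNorm (onVertical (damp ε F) x) 1 volume ≤
      eLpNorm k (ENNReal.ofReal p') volume * B := by
    refine le_trans ?_ ((eLpNorm_smul_le_mul_eLpNorm (r := 1)
      (continuous_onVertical hFa.continuousOn hx).aestronglyMeasurable hkm.1).trans
      (mul_le_mul_right (hb x hx) _))
    refine eLpNorm_mono fun η => ?_
    rw [Pi.smul_apply', norm_smul]
    have h1 := norm_damp_factor_le hε.le (vertical_mem hx η)
    have him : ((x : ℂ) + 2 * Real.pi * η * Complex.I).im = 2 * Real.pi * η := by simp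
    rw [him, ← mul_assoc] at h1
    rw [onVertical, damp, norm_mul]
    exact mul_le_mul_of_nonneg_right (h1.trans (le_abs_self _)) (norm_nonneg _)
  have hi : Integrable (onVertical (damp ε F) x) :=
    memLp_one_iff_integrable.1 ⟨hc.aestronglyMeasurable, hle.trans_lt hBk.lt_top⟩
  refine ⟨hi, ?_⟩
  rw [integral_norm_eq_lintegral_enorm hi.1, ← eLpNorm_one_eq_lintegral_enorm]
  exact ENNReal.toReal_mono hBk hle

end Damping

/-! ### Inverse Laplace transform on `H^p` and its smoothness. -/

section InverseLaplace

open Topology FourierTransform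

theorem tendsto_damp (G : ℂ → ℂ) (s : ℂ) :
    Tendsto (fun n : ℕ => damp (1 / ((n : ℝ) + 1)) G s) atTop (𝓝 (G s)) := by
  have h1 : ContinuousAt (fun ε : ℝ => damp ε G s) 0 := by
    unfold damp
    refine ContinuousAt.mul (ContinuousAt.inv₀ (by fun_prop) (by simp)) continuousAt_const
  have h2 : damp 0 G s = G s := by simp [damp]
  have h3 := h1.tendsto.comp (tendsto_one_div_add_atTop_nhds_zero_nat (𝕜 := ℝ))
  rw [h2] at h3
  exact h3

/-- The inverse Laplace transform of a function in `H^p` which is integrable on a vertical line. -/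
theorem isInverseLaplace_bromwich {p p' : ℝ} (hpq : p.HolderConjugate p') (hp2 : p ≤ 2)
    {G : ℂ → ℂ} (hG : MemHardy p G) {σ : ℝ} (hσ : 0 < σ) (hi : Integrable (onVertical G σ)) :
    IsInverseLaplace p' G (bromwich G σ) := by
  obtain ⟨hGa, B, hB, hb⟩ := (memHardy_iff hpq.pos).1 hG
  set ε : ℕ → ℝ := fun n => 1 / ((n : ℝ) + 1) with hε
  have hε0 : ∀ n, 0 < ε n := fun n => by positivity
  have hFa : ∀ n, AnalyticOnNhd ℂ (damp (ε n) G) rightHalfPlane :=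
    fun n => analyticOnNhd_damp (hε0 n).le hGa
  choose A hA using fun n => exists_integral_onVertical_damp_le hpq (hε0 n) hG
  obtain ⟨C, hC, hHY⟩ := exists_eLpNorm_fourier_le hpq.lt hp2
    (by simpa using hpq.inv_add_inv_eq_one) hpq.symm.pos hB
  have hle : ∀ n x, 0 < x → ∀ η, ‖onVertical (damp (ε n) G) x η‖ ≤ ‖onVertical G x η‖ :=
    fun n x hx η => norm_damp_le (hε0 n).le (vertical_mem hx η)
  have hnorm : ∀ n, eLpNorm (bromwich (damp (ε n) G) σ) (ENNReal.ofReal p') halfLine ≤ C := by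
    intro n
    refine eLpNorm_bromwich_le (hFa n) (fun x hx => (hA n x hx).1) (fun x hx => (hA n x hx).2) hσ
      fun x hx => hHY _ ?_ (hA n x hx).1 ?_
    · exact (continuous_onVertical (hFa n).continuousOn hx).measurable
    · exact (eLpNorm_mono fun η => hle n x hx η).trans (hb x hx)
  have hlim : ∀ t, Tendsto (fun n => bromwich (damp (ε n) G) σ t) atTop
      (𝓝 (bromwich G σ t)) := by
    intro t
    refine Tendsto.const_mul _ ?_
    simp only [Real.fourierInv_eq']
    refine tendsto_integral_of_dominated_convergence (fun η => ‖onVertical G σ η‖) ?_ hi.norm ?_ ?_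
    · intro n
      have hc : Continuous fun η : ℝ =>
          Complex.exp (((2 * Real.pi * inner ℝ η t : ℝ) : ℂ) * Complex.I) := by fun_prop
      exact hc.aestronglyMeasurable.smul (hA n σ hσ).1.1
    · intro n
      refine ae_of_all _ fun η => ?_
      rw [norm_smul, Complex.norm_exp_ofReal_mul_I, one_mul]
      exact hle n σ hσ η
    · exact ae_of_all _ fun η => (tendsto_damp G _).const_smul _
  have hcont : Continuous (bromwich G σ) := continuous_bromwich hi
  have hmem : MemLpHalfLine p' (bromwich G σ) := by
    refine ⟨hcont.aestronglyMeasurable, lt_of_le_of_lt ?_ hC.lt_top⟩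
    exact Lp.eLpNorm_le_of_ae_tendsto (Eventually.of_forall hnorm)
      (fun n => (continuous_bromwich (hA n σ hσ).1).aestronglyMeasurable)
      (ae_of_all _ hlim)
  refine ⟨hmem, ?_⟩
  -- Integrability of the undamped `G` is available only on `Re s = σ`, which gives the dominating
  -- growth `e^{σ t}` and hence convergence for `Re s > σ`. The identity theorem covers the rest of
  -- the half-plane.
  have hfar : ∀ s : ℂ, σ < s.re → laplace (bromwich G σ) s = G s := by
    intro s hs
    have hs0 : s ∈ rightHalfPlane := hσ.trans hs
    have h1 : Tendsto (fun n => laplace (bromwich (damp (ε n) G) σ) s) atTop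
        (𝓝 (laplace (bromwich G σ) s)) := by
      have hre : ((σ - s.re : ℝ) : ℂ).re < 0 := by
        rw [Complex.ofReal_re]
        linarith
      refine tendsto_integral_of_dominated_convergence
        (fun t => ‖expMonomial ((σ - s.re : ℝ) : ℂ) 0 t‖ * ∫ η, ‖onVertical G σ η‖) ?_
        ((integrable_expMonomial hre 0).norm.mul_const _) ?_ ?_
      · intro n
        have := continuous_bromwich (hA n σ hσ).1
        exact Continuous.aestronglyMeasurable (by fun_prop)
      · intro n
        filter_upwards [ae_restrict_mem measurableSet_Ioi] with t ht
        have ht0 : 0 < t := ht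
        rw [norm_mul, Complex.norm_exp, norm_expMonomial _ _ ht0.le]
        have hr : (-s * t).re = -s.re * t := by simp
        have h2 : ∫ η, ‖onVertical (damp (ε n) G) σ η‖ ≤ ∫ η, ‖onVertical G σ η‖ :=
          integral_mono (hA n σ hσ).1.norm hi.norm (hle n σ hσ)
        have h3 := (norm_bromwich_le (damp (ε n) G) σ t).trans
          (mul_le_mul_of_nonneg_left h2 (Real.exp_pos _).le)
        rw [hr]
        refine (mul_le_mul_of_nonneg_left h3 (Real.exp_pos _).le).trans (le_of_eq ?_)
        rw [← mul_assoc, ← Real.exp_add, Complex.ofReal_re]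
        simp only [pow_zero, Nat.factorial_zero, Nat.cast_one, div_one, one_mul]
        congr 2
        ring
      · exact ae_of_all _ fun t => (hlim t).const_mul _
    refine tendsto_nhds_unique h1 ((tendsto_damp G s).congr fun n => ?_)
    exact (laplace_bromwich (hFa n) (fun x hx => (hA n x hx).1) (fun x hx => (hA n x hx).2)
      hσ hs0).symm
  intro s hs
  have hz : ((σ + 1 : ℝ) : ℂ) ∈ rightHalfPlane := by
    rw [mem_rightHalfPlane, Complex.ofReal_re]
    linarith
  refine (analyticOnNhd_laplace hpq hmem).eqOn_of_preconnected_of_eventuallyEq hGa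
    convex_rightHalfPlane.isPreconnected hz ?_ hs
  have hopen : IsOpen {s : ℂ | σ < s.re} := isOpen_lt continuous_const Complex.continuous_re
  filter_upwards [hopen.mem_nhds (show σ < ((σ + 1 : ℝ) : ℂ).re by
    rw [Complex.ofReal_re]; linarith)] with s hs using hfar s hs

theorem contDiff_bromwich {G : ℂ → ℂ} {σ : ℝ} {K : ℕ}
    (h : ∀ n ≤ K, Integrable fun η : ℝ => (η : ℂ) ^ n * onVertical G σ η) :
    ContDiff ℝ K (bromwich G σ) := by
  have h1 : ContDiff ℝ (K : ℕ∞) (𝓕 (onVertical G σ)) := by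
    refine Real.contDiff_fourier fun n hn => ?_
    refine (h n (by exact_mod_cast hn)).norm.congr (ae_of_all _ fun η => ?_)
    simp
  have h2 : 𝓕⁻ (onVertical G σ) = fun t => 𝓕 (onVertical G σ) (-t) :=
    funext (Real.fourierInv_eq_fourier_neg _)
  have h3 : ContDiff ℝ K (𝓕⁻ (onVertical G σ)) := by
    rw [h2]
    exact (show ContDiff ℝ K (𝓕 (onVertical G σ)) from h1).comp contDiff_neg
  have h4 : ContDiff ℝ K (fun t : ℝ => (t : ℂ)) := Complex.ofRealCLM.contDiff
  exact (contDiff_const.mul h4).cexp.mul h3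

/-- Moments on a vertical line, in the two scales. -/
theorem integrable_pow_mul_onVertical {G : ℂ → ℂ} {σ : ℝ} {n : ℕ}
    (h : Integrable fun y : ℝ => (y : ℂ) ^ n * G (σ + y * Complex.I)) :
    Integrable fun η : ℝ => (η : ℂ) ^ n * onVertical G σ η := by
  have h1 := (h.comp_mul_left' Real.two_pi_pos.ne').const_mul ((2 * Real.pi : ℂ) ^ n)⁻¹
  refine h1.congr (ae_of_all _ fun η => ?_)
  simp only [onVertical_eq]
  push_cast
  simp only [mul_pow]
  field_simp

end InverseLaplace

/-! ### Partial fractions lie in `H^p`. -/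

section PartialFractionHardy

variable {N : ℕ} {r : Fin N → ℕ}

/-- With `δ = -Re w`, one has `‖s - w‖ ≥ δ` on the half-plane. So `j` of the factors cost `δ^{-j}`,
and the last is dominated by a multiple of `(1 + |η|)^{-1}`, which is in `L^p` because `p > 1`. -/
theorem memHardy_const_mul_inv_pow {p : ℝ} (hp : 1 < p) {w : ℂ} (hw : w.re < 0) (a : ℂ) (j : ℕ) :
    MemHardy p (fun s => a * ((s - w) ^ (j + 1))⁻¹) := by
  have hp0 : 0 < p := by linarith
  have hne : ∀ s ∈ rightHalfPlane, s - w ≠ 0 := by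
    intro s hs h
    have h1 := congrArg Complex.re h
    have hs0 : 0 < s.re := hs
    simp only [Complex.sub_re, Complex.zero_re] at h1
    linarith
  set δ : ℝ := -w.re with hδ
  have hδ0 : 0 < δ := by linarith
  set c : ℝ := 1 + (1 + |w.im|) / δ with hc
  set k : ℝ → ℝ := fun η => ‖a‖ * ((δ ^ j)⁻¹ * c) * (1 + ‖η‖) ^ (-(1 : ℝ)) with hk
  have hkm : MemLp k (ENNReal.ofReal p) volume := by
    refine MemLp.const_mul ?_ _
    have hcont : Continuous fun η : ℝ => (1 + ‖η‖) ^ (-(1 : ℝ)) :=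
      Continuous.rpow_const (by fun_prop) fun η => Or.inl (by positivity)
    refine (integrable_norm_rpow_iff hcont.aestronglyMeasurable (by simpa using hp0)
      ENNReal.ofReal_ne_top).1 ?_
    rw [ENNReal.toReal_ofReal hp0.le]
    have h1 : Integrable fun η : ℝ => (1 + ‖η‖) ^ (-p) := integrable_one_add_norm (by simpa using hp)
    refine h1.congr (ae_of_all _ fun η => ?_)
    simp only
    rw [Real.norm_of_nonneg (Real.rpow_nonneg (by positivity) _), ← Real.rpow_mul (by positivity)]
    simp
  refine (memHardy_iff hp0).2 ⟨fun s hs => ?_, eLpNorm k (ENNReal.ofReal p) volume, hkm.2.ne,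
    fun x hx => ?_⟩
  · exact analyticAt_const.mul (AnalyticAt.inv (by fun_prop) (pow_ne_zero _ (hne s hs)))
  · refine eLpNorm_mono fun η => ?_
    set s : ℂ := (x : ℂ) + 2 * Real.pi * η * Complex.I with hs
    have him : (s - w).im = 2 * Real.pi * η - w.im := by simp [hs]
    have hre : (s - w).re = x + δ := by simp [hs, hδ, sub_eq_add_neg]
    have h1 : δ ≤ ‖s - w‖ := by
      have := (le_abs_self _).trans (Complex.abs_re_le_norm (s - w))
      rw [hre] at this
      linarith
    have h2 : ‖η‖ ≤ ‖s - w‖ + |w.im| := by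
      have h3 := Complex.abs_im_le_norm (s - w)
      rw [him] at h3
      have h4 : |2 * Real.pi * η| ≤ |2 * Real.pi * η - w.im| + |w.im| := by
        simpa using abs_add_le (2 * Real.pi * η - w.im) w.im
      rw [abs_mul, abs_of_pos Real.two_pi_pos] at h4
      have h5 : (1 : ℝ) ≤ 2 * Real.pi := by linarith [Real.pi_gt_three]
      rw [Real.norm_eq_abs]
      nlinarith [abs_nonneg η]
    have h3 : 1 + ‖η‖ ≤ c * ‖s - w‖ := by
      have h4 : 1 + |w.im| ≤ (1 + |w.im|) / δ * ‖s - w‖ := by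
        rw [div_mul_eq_mul_div, le_div_iff₀ hδ0]
        exact mul_le_mul_of_nonneg_left h1 (by positivity)
      rw [hc, add_mul, one_mul]
      linarith
    have hpos : 0 < ‖s - w‖ := hδ0.trans_le h1
    have h4 : ‖s - w‖⁻¹ ≤ c * (1 + ‖η‖)⁻¹ := by
      rw [← div_eq_mul_inv, inv_le_comm₀ hpos (by positivity), inv_div, div_le_iff₀ (by positivity)]
      linarith
    rw [onVertical, ← hs, norm_mul, norm_inv, norm_pow, hk]
    simp only [Real.rpow_neg_one]
    refine le_trans ?_ (le_abs_self _)
    rw [mul_assoc ‖a‖, mul_assoc ((δ ^ j)⁻¹), pow_succ, mul_inv]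
    gcongr

theorem memHardy_zero {p : ℝ} (hp : 0 < p) : MemHardy p 0 :=
  (memHardy_iff hp).2 ⟨fun _ _ => analyticAt_const, 0, ENNReal.zero_ne_top, fun x _ => by
    have : onVertical 0 x = 0 := rfl
    rw [this, eLpNorm_zero]⟩

theorem memHardy_partialFraction {p : ℝ} (hp : 1 < p) {ω : Fin N → ℂ} (hω : ∀ i, (ω i).re < 0)
    (a : (i : Fin N) × Fin (r i) → ℂ) : MemHardy p (partialFraction ω a) := by
  have h : partialFraction ω a = ∑ c, fun s => a c * ((s - ω c.1) ^ ((c.2 : ℕ) + 1))⁻¹ := by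
    funext s
    rw [partialFraction, Finset.sum_apply]
  rw [h]
  exact Finset.sum_induction _ (MemHardy p) (fun _ _ hF hG => hF.add hp.le hG)
    (memHardy_zero (by linarith)) fun c _ => memHardy_const_mul_inv_pow hp (hω c.1) (a c) c.2

end PartialFractionHardy

/-! ### Exponential polynomials and their initial data. -/

section ExpPolynomial

variable {N : ℕ} {r : Fin N → ℕ}

/-- The function `t ↦ ∑ a_{ij} (t^j / j!) e^{ω_i t}`. -/
noncomputable def expPolynomial (ω : Fin N → ℂ) (a : (i : Fin N) × Fin (r i) → ℂ) (t : ℝ) : ℂ :=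
  ∑ c, a c * expMonomial (ω c.1) c.2 t

theorem contDiff_expPolynomial (ω : Fin N → ℂ) (a : (i : Fin N) × Fin (r i) → ℂ)
    {n : WithTop ℕ∞} : ContDiff ℝ n (expPolynomial ω a) :=
  ContDiff.sum fun c _ => contDiff_const.mul (contDiff_expMonomial (ω c.1) c.2)

theorem memLpHalfLine_expPolynomial {q : ℝ} (hq : 0 < q) {ω : Fin N → ℂ}
    (hω : ∀ i, (ω i).re < 0) (a : (i : Fin N) × Fin (r i) → ℂ) :
    MemLpHalfLine q (expPolynomial ω a) :=
  memLp_finsetSum _ fun c _ => (memLpHalfLine_expMonomial (hω c.1) c.2 hq).const_mul (a c)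

theorem laplace_expPolynomial {ω : Fin N → ℂ} (hω : ∀ i, (ω i).re < 0)
    (a : (i : Fin N) × Fin (r i) → ℂ) {s : ℂ} (hs : s ∈ rightHalfPlane) :
    laplace (expPolynomial ω a) s = partialFraction ω a s := by
  have hs0 : 0 < s.re := hs
  have hint : ∀ c ∈ (Finset.univ : Finset ((i : Fin N) × Fin (r i))), Integrable
      (fun t : ℝ => a c * (Complex.exp (-s * t) * expMonomial (ω c.1) c.2 t)) halfLine := by
    intro c _
    -- Exponential monomials lie in every `L^q`, so the exponent `2` is only a convenient choice.
    exact (integrable_laplace_integrand Real.HolderConjugate.two_two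
      (memLpHalfLine_expMonomial (hω c.1) c.2 two_pos) hs).const_mul _
  have h1 : laplace (expPolynomial ω a) s = ∫ t, ∑ c, a c *
      (Complex.exp (-s * t) * expMonomial (ω c.1) c.2 t) ∂halfLine := by
    refine integral_congr_ae (ae_of_all _ fun t => ?_)
    simp only [expPolynomial, Finset.mul_sum]
    exact Finset.sum_congr rfl fun c _ => by ring
  rw [h1, integral_finsetSum _ hint, partialFraction]
  refine Finset.sum_congr rfl fun c _ => ?_
  rw [integral_const_mul]
  congr 1
  exact laplace_expMonomial c.2 ((hω c.1).trans hs0)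

/-- The initial data of an exponential polynomial are given by the matrix of the linear system. -/
theorem iteratedDeriv_expPolynomial_zero (ω : Fin N → ℂ) (b : Fin (∑ i, r i) → ℂ)
    (n : Fin (∑ i, r i)) :
    iteratedDeriv n (expPolynomial ω fun c => b (finSigmaFinEquiv c)) 0 =
      (evalInitialMatrix r ω).mulVec b n := by
  have h1 : iteratedDeriv n (expPolynomial ω fun c => b (finSigmaFinEquiv c)) 0 =
      ∑ c, iteratedDeriv n (fun t => b (finSigmaFinEquiv c) * expMonomial (ω c.1) c.2 t) 0 :=
    iteratedDeriv_fun_sum fun c _ =>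
      (contDiff_const.mul (contDiff_expMonomial (ω c.1) c.2)).contDiffAt
  rw [h1, Matrix.mulVec, dotProduct, ← finSigmaFinEquiv.sum_comp]
  refine Finset.sum_congr rfl fun c _ => ?_
  rw [iteratedDeriv_const_mul_field, iteratedDeriv_expMonomial_zero, evalInitialMatrix_apply_sigma]
  ring

theorem iteratedDerivWithin_add_expPolynomial {φ : ℝ → ℂ} {K : ℕ} (hφ : ContDiff ℝ K φ)
    (hK : ∑ i, r i ≤ K) (ω : Fin N → ℂ) (b : Fin (∑ i, r i) → ℂ) (n : Fin (∑ i, r i)) :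
    iteratedDerivWithin n (φ + expPolynomial ω fun c => b (finSigmaFinEquiv c)) (Ici 0) 0 =
      iteratedDeriv n φ 0 + (evalInitialMatrix r ω).mulVec b n := by
  have hφn : ContDiff ℝ (n : ℕ) φ := hφ.of_le (by exact_mod_cast n.2.le.trans hK)
  have he := contDiff_expPolynomial ω (fun c => b (finSigmaFinEquiv c)) (n := (n : ℕ))
  have hsum : ContDiff ℝ (n : ℕ) (φ + expPolynomial ω fun c => b (finSigmaFinEquiv c)) :=
    hφn.add he
  rw [iteratedDerivWithin_eq_iteratedDeriv (uniqueDiffOn_Ici 0) hsum.contDiffAt self_mem_Ici, iteratedDeriv_add hφn.contDiffAt he.contDiffAt, iteratedDeriv_expPolynomial_zero]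

end ExpPolynomial

/-! ### Solutions in terms of Laplace transforms. -/

section Solutions

open Topology

variable {p p' : ℝ} {D : Set ℂ} {f G r₁ R₁ : ℂ → ℂ} {J : ℝ → ℂ} {N : ℕ} {ω : Fin N → ℂ}

theorem rightHalfPlane_subset_diff (hD : rightHalfPlane ⊆ D) (hω : ∀ i, (ω i).re < 0) :
    rightHalfPlane ⊆ D \ range ω := by
  refine fun s hs => ⟨hD hs, ?_⟩
  rintro ⟨i, rfl⟩
  exact lt_asymm (hω i) hs

/-- The Laplace transform of a solution. -/
theorem IsNonlocalSolution.laplace_eq (hpq : p.HolderConjugate p') (hDc : IsConnected D)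
    (hD : rightHalfPlane ⊆ D) (hf : AnalyticOnNhd ℂ f D) (hf0 : ∃ s ∈ D, f s ≠ 0)
    (hG : AnalyticOnNhd ℂ G rightHalfPlane) (hfG : ∀ s ∈ rightHalfPlane, f s * G s = laplace J s)
    (hR : AnalyticOnNhd ℂ R₁ rightHalfPlane) (hfR : ∀ s ∈ rightHalfPlane, f s * R₁ s = r₁ s)
    {ψ : ℝ → ℂ} (hψ : IsNonlocalSolution p p' f r₁ J ψ) {s : ℂ} (hs : s ∈ rightHalfPlane) :
    laplace ψ s = G s + R₁ s := by
  refine eq_of_mul_eq hDc hf hf0 isOpen_rightHalfPlane hD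
    (analyticOnNhd_laplace hpq hψ.1).continuousOn (hG.add hR).continuousOn (fun z hz => ?_) hs
  have h1 : laplace J z = f z * laplace ψ z - r₁ z := hψ.2.2.2 z hz
  rw [← hfG z hz, ← hfR z hz] at h1
  rw [Pi.add_apply]
  linear_combination -h1

theorem isNonlocalSolution_of_laplace_eq (hp : 0 < p) (hJ : MemLpHalfLine p' J)
    (hLJ : MemHardy p (laplace J)) (hfG : ∀ s ∈ rightHalfPlane, f s * G s = laplace J s)
    (hfR : ∀ s ∈ rightHalfPlane, f s * R₁ s = r₁ s) {φ : ℝ → ℂ} (hφ : MemLpHalfLine p' φ)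
    (h : ∀ s ∈ rightHalfPlane, laplace φ s = G s + R₁ s) :
    IsNonlocalSolution p p' f r₁ J φ := by
  have h1 : ∀ s ∈ rightHalfPlane, laplace J s = f s * laplace φ s - r₁ s := by
    intro s hs
    rw [h s hs, ← hfR s hs, ← hfG s hs]
    ring
  exact ⟨hφ, hLJ.congr hp h1, hJ, h1⟩

/-- Transforms determine functions only almost everywhere, whereas initial data are pointwise;
continuity up to the end point bridges the gap. -/
theorem eqOn_Ici_of_ae_eq_halfLine {g h : ℝ → ℂ} (hg : ContinuousOn g (Ici 0))
    (hh : ContinuousOn h (Ici 0)) (he : g =ᵐ[halfLine] h) : EqOn g h (Ici 0) := by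
  rw [halfLine, Measure.restrict_congr_set Ioi_ae_eq_Ici] at he
  exact Measure.eqOn_of_ae_eq he hg hh (by simp)

end Solutions

/-! ### Assembly of the main theorem. -/

theorem theorem3 (p p' : ℝ) (hp : 1 < p) (hp2 : p ≤ 2) (hp' : 0 < p') (hpp' : 1 / p + 1 / p' = 1)
    (N : ℕ) (r : Fin N → ℕ) (hr : ∀ i, 0 < r i)
    (D : Set ℂ) (hDo : IsOpen D) (hDc : IsConnected D) (hD : rightHalfPlane ⊆ D)
    (f : ℂ → ℂ) (hf : AnalyticOnNhd ℂ f D) (hf0 : ∃ s ∈ D, f s ≠ 0)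
    (J : ℝ → ℂ) (hJ : MemLpHalfLine p' J) (hLJ : MemHardy p (laplace J))
    (hLJf : QuotientMemHardy p (laplace J) f)
    (M : ℕ) (hM : ∑ i, r i ≤ M) (σ : ℝ) (hσ : 0 < σ)
    (hint : ∀ n : ℕ, n ≤ M → Integrable (fun y : ℝ => (y : ℂ) ^ n *
      (laplace J ((σ : ℂ) + (y : ℂ) * Complex.I) / f ((σ : ℂ) + (y : ℂ) * Complex.I)))) :
    -- the exceptional set of points is a proper algebraic variety
    initialDet r ≠ 0 ∧
    ∀ ω : Fin N → ℂ, (∀ i, (ω i).re < 0) → MvPolynomial.eval ω (initialDet r) ≠ 0 →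
      -- the exceptional sets of data, where the order of a pole drops, are affine hyperplanes
      ∃ (l : Fin N → ((Fin (∑ i, r i) → ℂ) →ₗ[ℂ] ℂ)) (c : Fin N → ℂ), (∀ i, l i ≠ 0) ∧
      ∀ d : Fin (∑ i, r i) → ℂ, ∃ (r₀ R : ℂ → ℂ) (φ : ℝ → ℂ),
        IsAdmissible p D f J ω r r₀ R ∧
        (∀ i, HasPoleOfOrder R (ω i) (r i) ↔ l i d ≠ c i) ∧
        -- the solution belonging to `r₀`
        IsNonlocalSolution p p' f r₀ J φ ∧
        (∀ ψ : ℝ → ℂ, IsNonlocalSolution p p' f r₀ J ψ → ψ =ᵐ[halfLine] φ) ∧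
        (∀ G : ℂ → ℂ, IsHardyQuotient p (fun s => laplace J s + r₀ s) f G →
          IsInverseLaplace p' G φ) ∧
        HasInitialData d φ ∧
        -- uniqueness of `r₀`
        (∀ (r₁ R₁ : ℂ → ℂ) (ψ : ℝ → ℂ), IsAdmissible p D f J ω r r₁ R₁ →
          IsNonlocalSolution p p' f r₁ J ψ → HasInitialData d ψ →
          EqOn r₁ r₀ (D \ range ω)) := by
  have hpq : p.HolderConjugate p' := Real.holderConjugate_iff.2 ⟨hp, by simpa using hpp'⟩
  have hp0 : 0 < p := by linarith
  obtain ⟨G, hG, hfG⟩ := hLJf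
  have hmom : ∀ n ≤ ∑ i, r i,
      Integrable fun y : ℝ => (y : ℂ) ^ n * G ((σ : ℂ) + (y : ℂ) * Complex.I) := by
    intro n hn
    -- The pointwise quotient takes the value `0` at zeros of `f`, unlike `G`, but those form a null
    -- set on the line.
    refine (hint n (hn.trans hM)).congr ?_
    filter_upwards [ae_vertical_line_ne_zero hDc hf hf0 hD hσ] with y hy
    rw [← hfG _ (by rw [mem_rightHalfPlane]; simpa using hσ), mul_div_cancel_left₀ _ hy]
  have hGσ : Integrable (onVertical G σ) := by
    rw [integrable_onVertical_iff]
    simpa using hmom 0 (Nat.zero_le _)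
  set φ₀ : ℝ → ℂ := bromwich G σ with hφ₀
  have hφ₀L : IsInverseLaplace p' G φ₀ := isInverseLaplace_bromwich hpq hp2 hG hσ hGσ
  have hφ₀C : ContDiff ℝ ((∑ i, r i : ℕ)) φ₀ :=
    contDiff_bromwich fun n hn => integrable_pow_mul_onVertical (hmom n hn)
  refine ⟨initialDet_ne_zero r, fun ω hω hdet => ?_⟩
  have hinj : Function.Injective ω := injective_of_eval_initialDet_ne_zero hr hdet
  have hsub := rightHalfPlane_subset_diff hD hω
  set A := evalInitialMatrix r ω with hA
  have hAu : IsUnit A.det := by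
    rw [hA, det_evalInitialMatrix]
    exact hdet.isUnit
  set L : Fin (∑ i, r i) → ℂ := fun n => iteratedDeriv n φ₀ 0 with hL
  -- The index of the coefficient of `(s - ω i)^{-r i}`.
  set last : Fin N → Fin (∑ i, r i) :=
    fun i => finSigmaFinEquiv ⟨i, ⟨r i - 1, Nat.sub_lt (hr i) one_pos⟩⟩ with hlast
  have hAA : ∀ v, A⁻¹.mulVec (A.mulVec v) = v := fun v => by
    rw [Matrix.mulVec_mulVec, Matrix.nonsing_inv_mul A hAu, Matrix.one_mulVec]
  have hAA' : ∀ v, A.mulVec (A⁻¹.mulVec v) = v := fun v => by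
    rw [Matrix.mulVec_mulVec, Matrix.mul_nonsing_inv A hAu, Matrix.one_mulVec]
  refine ⟨fun i => (LinearMap.proj (last i)).comp A⁻¹.mulVecLin,
    fun i => A⁻¹.mulVec L (last i), fun i h => ?_, fun d => ?_⟩
  -- The functional takes the value `1` at the column `last i` of `A`.
  · have h1 : A⁻¹.mulVec (A.mulVec (Pi.single (last i) 1)) (last i) = 0 :=
      congrArg (fun T => T (A.mulVec (Pi.single (last i) 1))) h
    rw [hAA, Pi.single_eq_same] at h1
    exact one_ne_zero h1
  -- The solution of `L + A b = d`, where `L` collects the initial derivatives of `φ₀`.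
  set b : Fin (∑ i, r i) → ℂ := A⁻¹.mulVec (d - L) with hb
  set a : (i : Fin N) × Fin (r i) → ℂ := fun c => b (finSigmaFinEquiv c) with ha
  set R : ℂ → ℂ := partialFraction ω a with hR
  have hRH : MemHardy p R := memHardy_partialFraction hp hω a
  have hfR : ∀ s ∈ rightHalfPlane, f s * R s = (fun s => f s * R s) s := fun s _ => rfl
  have hφL : ∀ a' : (i : Fin N) × Fin (r i) → ℂ,
      MemLpHalfLine p' (φ₀ + expPolynomial ω a') ∧
      ∀ s ∈ rightHalfPlane, laplace (φ₀ + expPolynomial ω a') s =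
        G s + partialFraction ω a' s := by
    intro a'
    have h1 := memLpHalfLine_expPolynomial hp' hω a'
    refine ⟨hφ₀L.1.add h1, fun s hs => ?_⟩
    rw [laplace_add hpq hφ₀L.1 h1 hs, hφ₀L.2 s hs, laplace_expPolynomial hω a' hs]
  have hφC : ContDiff ℝ ((∑ i, r i : ℕ)) (φ₀ + expPolynomial ω a) :=
    hφ₀C.add (contDiff_expPolynomial ω a)
  have hsol : ∀ (r₁ R₁ : ℂ → ℂ) (ψ : ℝ → ℂ), (∀ s ∈ rightHalfPlane, f s * R₁ s = r₁ s) →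
      AnalyticOnNhd ℂ R₁ rightHalfPlane → IsNonlocalSolution p p' f r₁ J ψ →
      ∀ s ∈ rightHalfPlane, laplace ψ s = G s + R₁ s :=
    fun r₁ R₁ ψ hfR₁ hR₁ hψ s hs =>
      hψ.laplace_eq hpq hDc hD hf hf0 hG.1 hfG hR₁ hfR₁ hs
  refine ⟨fun s => f s * R s, R, φ₀ + expPolynomial ω a, ?_, fun i => ?_, ?_, ?_, ?_, ?_, ?_⟩
  · refine ⟨fun s hs => (hf s hs.1).mul (analyticOnNhd_partialFraction ω a s hs.2),
      fun s _ => rfl, hasPolesAtMost_partialFraction hinj hr a, hRH,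
      ⟨G + R, hG.add hp.le hRH, fun s hs => ?_⟩, ?_⟩
    · rw [Pi.add_apply, mul_add, hfG s hs]
    · obtain ⟨C, S, hS, h⟩ := norm_partialFraction_le ω a
      exact ⟨1, le_rfl, C, S, hS, by simpa using h⟩
  · rw [hasPoleOfOrder_partialFraction_iff hinj a (hr i)]
    have h1 : a ⟨i, ⟨r i - 1, Nat.sub_lt (hr i) one_pos⟩⟩ =
        A⁻¹.mulVec d (last i) - A⁻¹.mulVec L (last i) := by
      simp only [ha, hb, Matrix.mulVec_sub, Pi.sub_apply, hlast]
    rw [h1, sub_ne_zero]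
    rfl
  · exact isNonlocalSolution_of_laplace_eq hp0 hJ hLJ hfG hfR (hφL a).1 (hφL a).2
  · intro ψ hψ
    refine ae_eq_of_laplace_eq hpq hψ.1 (hφL a).1 fun s hs => ?_
    rw [hsol _ R ψ hfR hRH.1 hψ s hs, (hφL a).2 s hs]
  · intro G' hG'
    refine ⟨(hφL a).1, fun s hs => ?_⟩
    rw [(hφL a).2 s hs]
    refine eq_of_mul_eq hDc hf hf0 isOpen_rightHalfPlane hD (hG.1.add hRH.1).continuousOn
      hG'.1.1.continuousOn (fun z hz => ?_) hs
    rw [hG'.2 z hz, Pi.add_apply, mul_add, hfG z hz]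
  · refine ⟨hφC.contDiffOn, fun n => ?_⟩
    rw [ha, iteratedDerivWithin_add_expPolynomial hφ₀C le_rfl ω b n, ← hA, hb, hAA']
    simp [hL]
  · intro r₁ R₁ ψ hadm hψ hdat s hs
    obtain ⟨q, hq, C, S, -, hCS⟩ := hadm.decay
    -- Liouville makes any competitor a partial fraction too. Its coefficients satisfy the same
    -- invertible system, hence agree with `a`.
    obtain ⟨a₁, ha₁⟩ := exists_eq_partialFraction hinj hadm.poles
      (tendsto_cocompact_of_decay (by linarith) hCS)
    set b₁ : Fin (∑ i, r i) → ℂ := fun k => a₁ (finSigmaFinEquiv.symm k) with hb₁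
    have hab : a₁ = fun c => b₁ (finSigmaFinEquiv c) := by
      funext c
      simp only [hb₁, Equiv.symm_apply_apply]
    have hae : ψ =ᵐ[halfLine] φ₀ + expPolynomial ω a₁ := by
      refine ae_eq_of_laplace_eq hpq hψ.1 (hφL a₁).1 fun z hz => ?_
      rw [hsol r₁ R₁ ψ (fun z hz => hadm.quotient z (hsub hz)) hadm.memHardy.1 hψ z hz,
        (hφL a₁).2 z hz, ha₁ z (hsub hz).2]
    have heq : EqOn ψ (φ₀ + expPolynomial ω a₁) (Ici 0) :=
      eqOn_Ici_of_ae_eq_halfLine hdat.1.continuousOn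
        (hφ₀C.continuous.add (contDiff_expPolynomial ω a₁ (n := 0)).continuous).continuousOn hae
    have hb₁b : b₁ = b := by
      rw [hb, ← hAA b₁]
      congr 1
      funext n
      have h1 := hdat.2 n
      rw [iteratedDerivWithin_congr heq self_mem_Ici, hab,
        iteratedDerivWithin_add_expPolynomial hφ₀C le_rfl ω b₁ n] at h1
      rw [Pi.sub_apply, ← h1, hL, add_sub_cancel_left]
    have haa : a₁ = a := by rw [hab, hb₁b]
    rw [← hadm.quotient s hs, ha₁ s hs.2, haa]
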